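/- Let $\mathbb{k}$ be a field of characteristic zero, $R$ a commutative $\mathbb{k}$-algebra, and $D_{R|\mathbb{k}}=\bigcup_i D^i_{R|\mathbb{k}}\subseteq \operatorname{End}_{\mathbb{k}}(R)$ its ring of $\mathbb{k}$-linear differential operators, where $D^i_{R|\mathbb{k}}$ consists of the operators of order $\le i$. Definitions. A filtration $F_\bullet$ on a $\mathbb{k}$-algebra $A$ is an ascending exhaustive sequence $(F_i)_{i\in\mathbb{N}}$ of finite-dimensional $\mathbb{k}$-subspaces with $F_0=\mathbb{k}$ and $F_iF_j\subseteq F_{i+j}$. A filtration $G_\bullet$ on a left $A$-module compatible with $F_\bullet$ is an ascending exhaustive sequence of finite-dimensional $\mathbb{k}$-subspaces with $F_iG_j\subseteq G_{i+j}$. For such a sequence, $\operatorname{Dim}(G_\bullet)=\inf\{t\in\mathbb{R}_{\ge 0} : \lim_{i\to\infty} \dim_{\mathbb{k}}(G_i)/i^t=0\}\in[0,\infty]$, and its multiplicity is $\mathrm{e}(G_\bullet)=\limsup_{i\to\infty} \dim_{\mathbb{k}}(G_i)/i^{d}\in[0,\infty]$ if $d=\operatorname{Dim}(G_\bullet)<\infty$,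 and $\mathrm{e}(G_\bullet)=\infty$ otherwise. The pair $(A,F_\bullet)$ is linearly simple if there is an integer $C\ge 1$ such that $1\in F_{Ci}\,\delta\,F_{Ci}$ for all $i\in\mathbb{N}$ and all nonzero $\delta\in F_i$, where $F_{Ci}\,\delta\,F_{Ci}$ denotes the span of the products. If $(A,F_\bullet)$ is linearly simple with $\operatorname{Dim}(F_\bullet)<\infty$ and $0<\mathrm{e}(F_\bullet)<\infty$, a left $A$-module is holonomic if it is zero or admits a filtration $G_\bullet$ compatible with $F_\bullet$ such that $\operatorname{Dim}(G_\bullet)=\frac12\operatorname{Dim}(F_\bullet)$ and $\mathrm{e}(G_\bullet)<\infty$. Let $s$ be an indeterminate and $R(s)=R\otimes_{\mathbb{k}}\mathbb{k}(s)$. For $f\in R$, let $R_f(s)\boldsymbol{f^s}$ be the left $D_{R(s)|\mathbb{k}(s)}$-module whose underlying space is $R_f(s)=R_f\otimes_{\mathbb{k}}\mathbb{k}(s)$, where $a\in R_f(s)$ stands for $a\boldsymbol{f^s}$, with the action $$\delta\bullet a\boldsymbol{f^s}=\Big(\sum_{i=0}^{\operatorname{ord}(\delta)}\binom{s}{i}f^{-i}\,\delta^{(i)}(a)\Big)\boldsymbol{f^s},\qquad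 \delta^{(0)}=\delta,\quad \delta^{(i)}=[\delta^{(i-1)},f],\quad \binom{s}{i}=\frac{s(s-1)\cdots(s-i+1)}{i!},$$ where differential operators on $R(s)$ act on the localization $R_f(s)$ in the usual way. Theorem. Let $F_\bullet$ be a filtration on $D_{R|\mathbb{k}}$ that is linearly dominated by the order filtration, i.e. there is an integer $C\ge 1$ with $F_i\subseteq D^{Ci}_{R|\mathbb{k}}$ for all $i$. Suppose that $(D_{R|\mathbb{k}},F_\bullet)$ is linearly simple with $\operatorname{Dim}(F_\bullet)<\infty$ and $0<\mathrm{e}(F_\bullet)<\infty$, and that $R$ is a holonomic $D_{R|\mathbb{k}}$-module. Set $\widetilde F_i=\mathbb{k}(s)\otimes_{\mathbb{k}}F_i$, regarded as the $\mathbb{k}(s)$-span in $D_{R(s)|\mathbb{k}(s)}$ of the operators $\mathrm{id}\otimes\delta$ with $\delta\in F_i$. Then for every nonzero $f\in R$, $R_f(s)\boldsymbol{f^s}$ is a holonomic $(D_{R(s)|\mathbb{k}(s)},\widetilde F_\bullet)$-module (in particular, $\widetilde F_\bullet$ is a filtration on $D_{R(s)|\mathbb{k}(s)}$ that is linearly simple,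 of finite dimension and of finite positive multiplicity), and $R_f(s)\boldsymbol{f^s}$ has finite length as a $D_{R(s)|\mathbb{k}(s)}$-module. -/

import Mathlib

open Filter Topology TensorProduct
open scoped ENNReal NNReal

noncomputable section

/-! ## Filtrations, dimension, multiplicity, linear simplicity -/

section Filtrations

variable {K A M : Type*} [Field K] [Ring A] [Algebra K A]
  [AddCommGroup M] [Module K M] [Module A M] [IsScalarTower K A M]

/-- A filtration on the `K`-algebra `A`: an ascending, exhaustive sequence of finite-dimensional
`K`-subspaces with `F 0 = K` and `F i * F j ⊆ F (i + j)`. -/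
structure IsAlgFiltration (F : ℕ → Submodule K A) : Prop where
  mono : Monotone F
  exhaustive : ∀ a : A, ∃ i, a ∈ F i
  finite : ∀ i, Module.Finite K (F i)
  zero_eq : F 0 = 1
  mul_le : ∀ i j, F i * F j ≤ F (i + j)

/-- A filtration on the left `A`-module `M` compatible with `F`. -/
structure IsModFiltration (F : ℕ → Submodule K A) (G : ℕ → Submodule K M) : Prop where
  mono : Monotone G
  exhaustive : ∀ m : M, ∃ i, m ∈ G i
  finite : ∀ i, Module.Finite K (G i)
  smul_mem : ∀ i j, ∀ a ∈ F i, ∀ m ∈ G j, a • m ∈ G (i + j)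

/-- `Dim G = inf {t ∈ ℝ≥0 | lim dim G i / i ^ t = 0}`, which is `∞` if there is no such `t`. -/
def filDim (G : ℕ → Submodule K M) : ℝ≥0∞ :=
  ⨅ (t : ℝ≥0)
    (_ : Tendsto (fun i : ℕ => (Module.finrank K (G i) : ℝ) / (i : ℝ) ^ (t : ℝ)) atTop (𝓝 0)),
    (t : ℝ≥0∞)

open Classical in
/-- `e G = limsup dim G i / i ^ d` where `d = Dim G`, and `e G = ∞` if `Dim G = ∞`. -/
def filMult (G : ℕ → Submodule K M) : ℝ≥0∞ :=
  if filDim G = ⊤ then ⊤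
  else limsup (fun i : ℕ =>
    ENNReal.ofReal ((Module.finrank K (G i) : ℝ) / (i : ℝ) ^ (filDim G).toReal)) atTop

/-- `(A, F)` is `C`-linearly simple for some positive integer `C`:
`1 ∈ F (C i) δ F (C i)` for every nonzero `δ ∈ F i`. -/
def IsLinearlySimple (F : ℕ → Submodule K A) : Prop :=
  ∃ C : ℕ, 0 < C ∧ ∀ i, ∀ δ ∈ F i, δ ≠ 0 →
    (1 : A) ∈ F (C * i) * Submodule.span K {δ} * F (C * i)

variable (M) in
/-- `M` is a holonomic `(A, F)`-module. This includes that `F` is a filtration on `A` for which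
`(A, F)` is linearly simple of finite dimension and of finite positive multiplicity. -/
structure IsHolonomic (F : ℕ → Submodule K A) : Prop where
  filtration : IsAlgFiltration F
  linearlySimple : IsLinearlySimple F
  dim_lt_top : filDim F < ⊤
  mult_pos : 0 < filMult F
  mult_lt_top : filMult F < ⊤
  holonomic : Subsingleton M ∨ ∃ G : ℕ → Submodule K M,
    IsModFiltration F G ∧ filDim G = filDim F / 2 ∧ filMult G < ⊤

end Filtrations

/-! ## Rings of differential operators -/

section DiffOp

variable (K S : Type*) [CommRing K] [CommRing S] [Algebra K S]

/-- The `K`-linear differential operators on `S` of order at most `n`: multiplications by elements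
of `S` for `n = 0`, and for `n + 1` the `δ` for which all commutators `[δ, r]`, `r ∈ S`, have order
at most `n`. -/
def diffOpOrder : ℕ → Submodule K (Module.End K S)
  | 0 => LinearMap.range (Algebra.lmul K S).toLinearMap
  | n + 1 =>
    { carrier := {δ | ∀ r : S,
        δ * Algebra.lmul K S r - Algebra.lmul K S r * δ ∈ diffOpOrder n}
      zero_mem' := fun r => by simp
      add_mem' := fun {a b} ha hb r => by
        have := add_mem (ha r) (hb r)
        rwa [show (a + b) * Algebra.lmul K S r - Algebra.lmul K S r * (a + b) =
          (a * Algebra.lmul K S r - Algebra.lmul K S r * a) +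
          (b * Algebra.lmul K S r - Algebra.lmul K S r * b) by noncomm_ring]
      smul_mem' := fun c a ha r => by
        have := Submodule.smul_mem _ c (ha r)
        rwa [smul_sub, ← smul_mul_assoc, ← mul_smul_comm] at this }

variable {K S}

theorem mem_diffOpOrder_succ {n : ℕ} {δ : Module.End K S} :
    δ ∈ diffOpOrder K S (n + 1) ↔
      ∀ r : S, δ * Algebra.lmul K S r - Algebra.lmul K S r * δ ∈ diffOpOrder K S n :=
  Iff.rfl

theorem mem_diffOpOrder_zero {δ : Module.End K S} :
    δ ∈ diffOpOrder K S 0 ↔ ∃ r : S, Algebra.lmul K S r = δ :=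
  Iff.rfl

theorem comm_eq_zero {δ : Module.End K S} (h : δ ∈ diffOpOrder K S 0) (r : S) :
    δ * Algebra.lmul K S r - Algebra.lmul K S r * δ = 0 := by
  obtain ⟨s, rfl⟩ := h
  ext x
  simp [mul_left_comm]

theorem comm_smul (δ a : Module.End K S) (c : K) :
    δ * (c • a) - (c • a) * δ = c • (δ * a - a * δ) := by
  rw [mul_smul_comm, smul_mul_assoc, smul_sub]

theorem comm_add (δ a b : Module.End K S) :
    δ * (a + b) - (a + b) * δ = (δ * a - a * δ) + (δ * b - b * δ) := by
  rw [mul_add, add_mul, add_sub_add_comm]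

theorem diffOpOrder_mono : Monotone (diffOpOrder K S) := by
  refine monotone_nat_of_le_succ fun n => ?_
  induction n with
  | zero => exact fun δ h r => by rw [comm_eq_zero h]; exact zero_mem _
  | succ n ih => exact fun δ h r => ih (h r)

theorem mul_mem_diffOpOrder : ∀ (N i j : ℕ), i + j = N → ∀ {δ ε : Module.End K S},
    δ ∈ diffOpOrder K S i → ε ∈ diffOpOrder K S j → δ * ε ∈ diffOpOrder K S N := by
  intro N
  induction N with
  | zero =>
    intro i j hij δ ε hδ hε
    obtain ⟨rfl, rfl⟩ : i = 0 ∧ j = 0 := by omega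
    obtain ⟨s, rfl⟩ := hδ
    obtain ⟨t, rfl⟩ := hε
    exact ⟨s * t, map_mul (Algebra.lmul K S) s t⟩
  | succ N ih =>
    intro i j hij δ ε hδ hε r
    rw [show δ * ε * Algebra.lmul K S r - Algebra.lmul K S r * (δ * ε) =
      δ * (ε * Algebra.lmul K S r - Algebra.lmul K S r * ε) +
      (δ * Algebra.lmul K S r - Algebra.lmul K S r * δ) * ε by
        rw [mul_sub, sub_mul]; simp only [mul_assoc]; abel]
    refine add_mem ?_ ?_
    · cases j with
      | zero => rw [comm_eq_zero hε, mul_zero]; exact zero_mem _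
      | succ j => exact ih i j (by omega) hδ (hε r)
    · cases i with
      | zero => rw [comm_eq_zero hδ, zero_mul]; exact zero_mem _
      | succ i => exact ih i j (by omega) (hδ r) hε

variable (K S)

/-- The differential operators of all orders as a subalgebra of `End_K(S)`. -/
def diffOpSubalgebra : Subalgebra K (Module.End K S) where
  carrier := {δ | ∃ n, δ ∈ diffOpOrder K S n}
  mul_mem' := fun ⟨i, hi⟩ ⟨j, hj⟩ => ⟨i + j, mul_mem_diffOpOrder _ i j rfl hi hj⟩
  add_mem' := fun ⟨i, hi⟩ ⟨j, hj⟩ => ⟨max i j,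
    add_mem (diffOpOrder_mono (le_max_left i j) hi) (diffOpOrder_mono (le_max_right i j) hj)⟩
  algebraMap_mem' := fun c => ⟨0, algebraMap K S c, by
    ext x; simp [Algebra.smul_def]⟩

/-- The ring `D_{S|K}` of `K`-linear differential operators on `S`. -/
def DiffOp : Type _ := diffOpSubalgebra K S

instance : Ring (DiffOp K S) := inferInstanceAs (Ring (diffOpSubalgebra K S))

instance : Algebra K (DiffOp K S) := inferInstanceAs (Algebra K (diffOpSubalgebra K S))

/-- The inclusion of `D_{S|K}` in `End_K(S)`. -/
def DiffOp.toEnd : DiffOp K S →ₐ[K] Module.End K S := (diffOpSubalgebra K S).val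

variable {K S}

/-- `D_{S|K}` acts on `S` by evaluation. -/
instance : Module (DiffOp K S) S := Module.compHom S (DiffOp.toEnd K S).toRingHom

instance : IsScalarTower K (DiffOp K S) S where
  smul_assoc c δ x := by
    change DiffOp.toEnd K S (c • δ) x = c • DiffOp.toEnd K S δ x
    rw [map_smul, LinearMap.smul_apply]

theorem DiffOp.smul_def (δ : DiffOp K S) (x : S) : δ • x = DiffOp.toEnd K S δ x := rfl

theorem DiffOp.toEnd_injective : Function.Injective (DiffOp.toEnd K S) :=
  Subtype.val_injective

variable (K) in
/-- Multiplication by `r ∈ S` as a differential operator. -/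
def mulOp (r : S) : DiffOp K S := ⟨Algebra.lmul K S r, 0, r, rfl⟩

theorem toEnd_mulOp (r : S) : DiffOp.toEnd K S (mulOp K r) = Algebra.lmul K S r := rfl

theorem mulOp_smul (r x : S) : mulOp K r • x = r * x := rfl

/-- The iterated commutators `δ^(0) = δ`, `δ^(i+1) = [δ^(i), g]`. -/
def adPow (g : S) (δ : DiffOp K S) : ℕ → DiffOp K S
  | 0 => δ
  | i + 1 => adPow g δ i * mulOp K g - mulOp K g * adPow g δ i

/-- The order of a differential operator: the least `n` such that it has order at most `n`. -/
def diffOrd (δ : DiffOp K S) : ℕ :=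
  sInf {n | DiffOp.toEnd K S δ ∈ diffOpOrder K S n}

/-- A sequence of subspaces of `D_{S|K}` is linearly dominated by the order filtration. -/
def IsDominatedByOrder (F : ℕ → Submodule K (DiffOp K S)) : Prop :=
  ∃ C : ℕ, 0 < C ∧ ∀ i, ∀ δ ∈ F i, DiffOp.toEnd K S δ ∈ diffOpOrder K S (C * i)

theorem mem_diffOrd (δ : DiffOp K S) : DiffOp.toEnd K S δ ∈ diffOpOrder K S (diffOrd δ) :=
  Nat.sInf_mem (s := {n | DiffOp.toEnd K S δ ∈ diffOpOrder K S n}) δ.2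

theorem toEnd_adPow_succ (g : S) (δ : DiffOp K S) (i : ℕ) :
    DiffOp.toEnd K S (adPow g δ (i + 1)) =
      DiffOp.toEnd K S (adPow g δ i) * Algebra.lmul K S g -
        Algebra.lmul K S g * DiffOp.toEnd K S (adPow g δ i) := by
  rw [adPow, map_sub, map_mul, map_mul, toEnd_mulOp]

theorem adPow_mem (g : S) (δ : DiffOp K S) {n : ℕ} : ∀ i,
    DiffOp.toEnd K S δ ∈ diffOpOrder K S (n + i) →
    DiffOp.toEnd K S (adPow g δ i) ∈ diffOpOrder K S n := by
  intro i
  induction i generalizing n with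
  | zero => exact id
  | succ i ih =>
    intro h
    rw [toEnd_adPow_succ]
    exact ih (n := n + 1) (by rwa [add_right_comm, add_assoc]) g

theorem adPow_eq_zero (g : S) (δ : DiffOp K S) {i : ℕ} (h : diffOrd δ < i) :
    adPow g δ i = 0 := by
  obtain ⟨j, rfl⟩ : ∃ j, i = diffOrd δ + 1 + j := ⟨i - (diffOrd δ + 1), by omega⟩
  clear h
  induction j with
  | zero =>
    apply DiffOp.toEnd_injective
    rw [map_zero, add_zero, toEnd_adPow_succ]
    exact comm_eq_zero (adPow_mem g δ (n := 0) (diffOrd δ) (by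
      rw [zero_add]; exact mem_diffOrd δ)) g
  | succ j ih =>
    rw [← add_assoc, adPow, ih, zero_mul, mul_zero, sub_zero]

theorem adPow_add (g : S) (δ ε : DiffOp K S) (i : ℕ) :
    adPow g (δ + ε) i = adPow g δ i + adPow g ε i := by
  induction i with
  | zero => rfl
  | succ i ih => simp only [adPow, ih, add_mul, mul_add]; abel

theorem adPow_smul (g : S) (c : K) (δ : DiffOp K S) (i : ℕ) :
    adPow g (c • δ) i = c • adPow g δ i := by
  induction i with
  | zero => rfl
  | succ i ih => simp only [adPow, ih, smul_sub, smul_mul_assoc, mul_smul_comm]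

theorem adPow_one (g : S) (i : ℕ) : adPow g (1 : DiffOp K S) (i + 1) = 0 := by
  induction i with
  | zero => simp [adPow]
  | succ i ih => rw [adPow, ih, zero_mul, mul_zero, sub_zero]

theorem adPow_adPow (g : S) (δ : DiffOp K S) (i j : ℕ) :
    adPow g (adPow g δ i) j = adPow g δ (i + j) := by
  induction j with
  | zero => rfl
  | succ j ih => rw [adPow, ih, ← add_assoc, adPow]

theorem adPow_mul (g : S) (δ ε : DiffOp K S) (n : ℕ) :
    adPow g (δ * ε) n = ∑ p ∈ Finset.HasAntidiagonal.antidiagonal n,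
      n.choose p.1 • (adPow g δ p.1 * adPow g ε p.2) := by
  induction n with
  | zero => simp [adPow]
  | succ n ih =>
    rw [Finset.sum_antidiagonal_choose_succ_nsmul
      (fun i j => adPow g δ i * adPow g ε j) n, adPow, ih, Finset.sum_mul, Finset.mul_sum,
      ← Finset.sum_sub_distrib, ← Finset.sum_add_distrib]
    refine Finset.sum_congr rfl fun p hp => ?_
    rw [← Nat.choose_symm_of_eq_add (Finset.HasAntidiagonal.mem_antidiagonal.mp hp).symm]
    simp only [adPow, smul_mul_assoc, mul_smul_comm, ← smul_sub, ← smul_add]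
    congr 1
    simp only [mul_sub, sub_mul, mul_assoc]
    abel

theorem adPow_apply_mul (g : S) (δ : DiffOp K S) (i : ℕ) (v : S) :
    adPow g δ i • (g * v) = g * adPow g δ i • v + adPow g δ (i + 1) • v := by
  rw [adPow, sub_smul, mul_smul, mul_smul, mulOp_smul, mulOp_smul, add_sub_cancel]

end DiffOp

/-! ## The module `S_g g^c` -/

section PowerModule

variable {K S : Type*} [Field K] [CharZero K] [CommRing S] [Algebra K S] (g : S)

/-- The extension to `S_g` of the action of `δ ∈ D_{S|K}` on `S`: writing `a = v / g ^ t`,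
`δ (v / g ^ t) = ∑ i ≤ ord δ, binom(-t, i) δ^(i)(v) / g ^ (t + i)`. The value does not depend on
how `a` is written as a fraction. -/
def locAct (δ : DiffOp K S) (a : Localization.Away g) : Localization.Away g :=
  ∑ i ∈ Finset.range (diffOrd δ + 1),
    Ring.choose (-((IsLocalization.Away.sec g a).2 : K)) i •
      (algebraMap S (Localization.Away g) (adPow g δ i • (IsLocalization.Away.sec g a).1) *
        IsLocalization.Away.invSelf g ^ ((IsLocalization.Away.sec g a).2 + i))

/-- The action `δ • a g^c = (∑ i ≤ ord δ, binom(c, i) g ^ (-i) δ^(i)(a)) g^c` of `D_{S|K}` on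
`S_g g^c`. -/
def powAct (c : K) (δ : DiffOp K S) (a : Localization.Away g) : Localization.Away g :=
  ∑ i ∈ Finset.range (diffOrd δ + 1),
    Ring.choose c i • (IsLocalization.Away.invSelf g ^ i * locAct g (adPow g δ i) a)

/-- Auxiliary: the value of `δ` on `(v / g ^ t) g^c`, divided by `g^c`. -/
def fracAct (c : K) (δ : DiffOp K S) (v : S) (t : ℕ) : Localization.Away g :=
  ∑ i ∈ Finset.range (diffOrd δ + 1),
    Ring.choose (c - (t : K)) i • (algebraMap S (Localization.Away g) (adPow g δ i • v) *
      IsLocalization.Away.invSelf g ^ (t + i))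

variable {g}

theorem fracAct_eq (c : K) (δ : DiffOp K S) (v : S) (t : ℕ) {N : ℕ} (hN : diffOrd δ < N) :
    fracAct g c δ v t = ∑ i ∈ Finset.range N,
      Ring.choose (c - (t : K)) i • (algebraMap S (Localization.Away g) (adPow g δ i • v) *
        IsLocalization.Away.invSelf g ^ (t + i)) := by
  refine Finset.sum_subset (Finset.range_subset_range.mpr hN) fun i _ hi => ?_
  rw [adPow_eq_zero g δ (by simpa using hi), zero_smul, map_zero, zero_mul, smul_zero]

theorem fracAct_succ (c : K) (δ : DiffOp K S) (v : S) (t : ℕ) :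
    fracAct g c δ (g * v) (t + 1) = fracAct g c δ v t := by
  have hu := IsLocalization.Away.mul_invSelf (S := Localization.Away g) g
  have h1 : ∀ i, algebraMap S (Localization.Away g) (adPow g δ i • (g * v)) *
      IsLocalization.Away.invSelf g ^ (t + 1 + i) =
      algebraMap S (Localization.Away g) (adPow g δ i • v) *
        IsLocalization.Away.invSelf g ^ (t + i) +
      algebraMap S (Localization.Away g) (adPow g δ (i + 1) • v) *
        IsLocalization.Away.invSelf g ^ (t + (i + 1)) := by
    intro i
    rw [adPow_apply_mul, map_add, map_mul]
    linear_combination (algebraMap S (Localization.Away g) (adPow g δ i • v) *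
      IsLocalization.Away.invSelf g ^ (t + i)) * hu
  have h2 : c - (t : K) = (c - ((t + 1 : ℕ) : K)) + 1 := by push_cast; ring
  have h3 : ∀ i, Ring.choose (c - (t : K)) (i + 1) =
      Ring.choose (c - ((t + 1 : ℕ) : K)) i + Ring.choose (c - ((t + 1 : ℕ) : K)) (i + 1) := by
    intro i
    rw [h2, Ring.choose_succ_succ]
  rw [fracAct_eq c δ v t (N := diffOrd δ + 1 + 1) (by omega), fracAct,
    Finset.sum_range_succ' _ (diffOrd δ + 1)]
  simp only [h1, h3, smul_add, add_smul, Finset.sum_add_distrib]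
  have h4 : ∑ i ∈ Finset.range (diffOrd δ + 1), Ring.choose (c - ((t + 1 : ℕ) : K)) i •
      (algebraMap S (Localization.Away g) (adPow g δ i • v) *
        IsLocalization.Away.invSelf g ^ (t + i)) =
      ∑ i ∈ Finset.range (diffOrd δ + 1 + 1), Ring.choose (c - ((t + 1 : ℕ) : K)) i •
      (algebraMap S (Localization.Away g) (adPow g δ i • v) *
        IsLocalization.Away.invSelf g ^ (t + i)) := by
    rw [Finset.sum_range_succ _ (diffOrd δ + 1), adPow_eq_zero g δ (Nat.lt_succ_self _)]
    simp
  rw [h4, Finset.sum_range_succ' _ (diffOrd δ + 1), Ring.choose_zero_right,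
    Ring.choose_zero_right]
  abel

theorem fracAct_shift (c : K) (δ : DiffOp K S) (v : S) (t n : ℕ) :
    fracAct g c δ (g ^ n * v) (t + n) = fracAct g c δ v t := by
  induction n with
  | zero => simp
  | succ n ih => rw [pow_succ', mul_assoc, ← add_assoc, fracAct_succ, ih]

theorem fracAct_congr (c : K) (δ : DiffOp K S) {v w : S} {t s : ℕ}
    (h : algebraMap S (Localization.Away g) v * IsLocalization.Away.invSelf g ^ t =
      algebraMap S (Localization.Away g) w * IsLocalization.Away.invSelf g ^ s) :
    fracAct g c δ v t = fracAct g c δ w s := by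
  have hu := IsLocalization.Away.mul_invSelf (S := Localization.Away g) g
  have hun : ∀ n : ℕ, algebraMap S (Localization.Away g) g ^ n *
      IsLocalization.Away.invSelf g ^ n = 1 := fun n => by rw [← mul_pow, hu, one_pow]
  have h1 : algebraMap S (Localization.Away g) (g ^ s * v) =
      algebraMap S (Localization.Away g) (g ^ t * w) := by
    simp only [map_mul, map_pow]
    linear_combination
      (algebraMap S (Localization.Away g) g ^ s * algebraMap S (Localization.Away g) g ^ t) * h
      - (algebraMap S (Localization.Away g) g ^ s * algebraMap S (Localization.Away g) v) * hun t
      + (algebraMap S (Localization.Away g) g ^ t * algebraMap S (Localization.Away g) w) * hun s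
  obtain ⟨n, hn⟩ := IsLocalization.Away.exists_of_eq g h1
  rw [← fracAct_shift c δ v t s, ← fracAct_shift c δ _ (t + s) n, hn, fracAct_shift,
    add_comm t s, fracAct_shift]

theorem sec_eq (a : Localization.Away g) :
    algebraMap S (Localization.Away g) (IsLocalization.Away.sec g a).1 *
      IsLocalization.Away.invSelf g ^ (IsLocalization.Away.sec g a).2 = a := by
  rw [← IsLocalization.Away.sec_spec, mul_assoc, map_pow, ← mul_pow,
    IsLocalization.Away.mul_invSelf, one_pow, mul_one]

/-- The formula for `locAct` holds for every way of writing an element as a fraction. -/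
theorem locAct_frac (δ : DiffOp K S) (v : S) (t : ℕ) :
    locAct g δ (algebraMap S (Localization.Away g) v * IsLocalization.Away.invSelf g ^ t) =
      fracAct g 0 δ v t := by
  rw [← fracAct_congr 0 δ (sec_eq _), locAct, fracAct]
  simp only [zero_sub]

theorem sum_triangle {L : Type*} [AddCommMonoid L] (h : ℕ → ℕ → L) (a b : ℕ)
    (h0 : ∀ j k, a < j ∨ b < k → h j k = 0) :
    ∑ l ∈ Finset.range (a + b + 1), ∑ p ∈ Finset.HasAntidiagonal.antidiagonal l, h p.1 p.2 =
      ∑ j ∈ Finset.range (a + 1), ∑ k ∈ Finset.range (b + 1), h j k := by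
  rw [← Finset.sum_product' (f := h), ← Finset.sum_fiberwise_of_maps_to
    (g := fun p : ℕ × ℕ => p.1 + p.2) (t := Finset.range (a + b + 1))]
  · refine Finset.sum_congr rfl fun l _ => (Finset.sum_subset ?_ ?_).symm
    · intro p hp
      simp only [Finset.mem_filter] at hp
      exact Finset.HasAntidiagonal.mem_antidiagonal.mpr hp.2
    · intro p hp hp'
      apply h0
      rw [Finset.HasAntidiagonal.mem_antidiagonal] at hp
      simp only [Finset.mem_filter, Finset.mem_product, Finset.mem_range] at hp'
      omega
  · intro p hp
    simp only [Finset.mem_product, Finset.mem_range] at hp ⊢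
    omega

theorem powAct_frac (c : K) (δ : DiffOp K S) (v : S) (t : ℕ) :
    powAct g c δ (algebraMap S (Localization.Away g) v * IsLocalization.Away.invSelf g ^ t) =
      fracAct g c δ v t := by
  set d := diffOrd δ with hd
  have hlt : ∀ i, diffOrd (adPow g δ i) < d + 1 := by
    intro i
    refine Nat.lt_succ_of_le (Nat.sInf_le ?_)
    exact adPow_mem g δ i (diffOpOrder_mono (Nat.le_add_right d i) (mem_diffOrd δ))
  have h1 : powAct g c δ
      (algebraMap S (Localization.Away g) v * IsLocalization.Away.invSelf g ^ t) =
      ∑ i ∈ Finset.range (d + 1), ∑ j ∈ Finset.range (d + 1),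
        (Ring.choose c i * Ring.choose (-(t : K)) j) •
          (algebraMap S (Localization.Away g) (adPow g δ (i + j) • v) *
            IsLocalization.Away.invSelf g ^ (t + (i + j))) := by
    refine Finset.sum_congr rfl fun i _ => ?_
    rw [locAct_frac, fracAct_eq 0 _ v t (hlt i), Finset.mul_sum, Finset.smul_sum]
    refine Finset.sum_congr rfl fun j _ => ?_
    rw [zero_sub, adPow_adPow, mul_smul_comm, mul_smul]
    congr 2
    ring
  rw [h1, ← sum_triangle, fracAct_eq c δ v t (N := d + d + 1) (by omega)]
  · refine Finset.sum_congr rfl fun l _ => ?_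
    rw [sub_eq_add_neg, Ring.add_choose_eq l (Commute.all c (-(t : K))), Finset.sum_smul]
    refine Finset.sum_congr rfl fun p hp => ?_
    rw [Finset.HasAntidiagonal.mem_antidiagonal.mp hp]
  · intro j k h
    rw [adPow_eq_zero g δ (by omega), zero_smul, map_zero, zero_mul, smul_zero]

theorem exists_frac (a : Localization.Away g) : ∃ (v : S) (t : ℕ),
    a = algebraMap S (Localization.Away g) v * IsLocalization.Away.invSelf g ^ t :=
  ⟨_, _, (sec_eq a).symm⟩

theorem exists_frac₂ (a b : Localization.Away g) : ∃ (v w : S) (t : ℕ),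
    a = algebraMap S (Localization.Away g) v * IsLocalization.Away.invSelf g ^ t ∧
    b = algebraMap S (Localization.Away g) w * IsLocalization.Away.invSelf g ^ t := by
  obtain ⟨v, t, rfl⟩ := exists_frac a
  obtain ⟨w, s, rfl⟩ := exists_frac b
  have hu := IsLocalization.Away.mul_invSelf (S := Localization.Away g) g
  have hun : ∀ n : ℕ, algebraMap S (Localization.Away g) g ^ n *
      IsLocalization.Away.invSelf g ^ n = 1 := fun n => by rw [← mul_pow, hu, one_pow]
  refine ⟨g ^ s * v, g ^ t * w, t + s, ?_, ?_⟩
  · rw [map_mul, map_pow]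
    linear_combination (-(algebraMap S (Localization.Away g) v *
      IsLocalization.Away.invSelf g ^ t)) * hun s
  · rw [map_mul, map_pow]
    linear_combination (-(algebraMap S (Localization.Away g) w *
      IsLocalization.Away.invSelf g ^ s)) * hun t

theorem fracAct_add (c : K) (δ : DiffOp K S) (v w : S) (t : ℕ) :
    fracAct g c δ (v + w) t = fracAct g c δ v t + fracAct g c δ w t := by
  simp only [fracAct, smul_add, map_add, add_mul, Finset.sum_add_distrib]

theorem powAct_add (c : K) (δ : DiffOp K S) (a b : Localization.Away g) :
    powAct g c δ (a + b) = powAct g c δ a + powAct g c δ b := by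
  obtain ⟨v, w, t, rfl, rfl⟩ := exists_frac₂ a b
  rw [← add_mul, ← map_add, powAct_frac, powAct_frac, powAct_frac, fracAct_add]

theorem add_powAct (c : K) (δ ε : DiffOp K S) (a : Localization.Away g) :
    powAct g c (δ + ε) a = powAct g c δ a + powAct g c ε a := by
  obtain ⟨v, t, rfl⟩ := exists_frac a
  set N := diffOrd δ + diffOrd ε + diffOrd (δ + ε) + 1
  rw [powAct_frac, powAct_frac, powAct_frac, fracAct_eq c δ v t (N := N) (by omega),
    fracAct_eq c ε v t (N := N) (by omega), fracAct_eq c (δ + ε) v t (N := N) (by omega)]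
  simp only [adPow_add, add_smul, map_add, add_mul, smul_add, Finset.sum_add_distrib]

theorem smul_powAct (c r : K) (δ : DiffOp K S) (a : Localization.Away g) :
    powAct g c (r • δ) a = r • powAct g c δ a := by
  obtain ⟨v, t, rfl⟩ := exists_frac a
  set N := diffOrd δ + diffOrd (r • δ) + 1
  rw [powAct_frac, powAct_frac, fracAct_eq c δ v t (N := N) (by omega),
    fracAct_eq c (r • δ) v t (N := N) (by omega), Finset.smul_sum]
  refine Finset.sum_congr rfl fun i _ => ?_
  rw [adPow_smul, smul_assoc, Algebra.smul_def r (adPow g δ i • v), map_mul,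
    ← IsScalarTower.algebraMap_apply, mul_assoc, ← Algebra.smul_def, smul_comm]

theorem one_powAct (c : K) (a : Localization.Away g) : powAct g c (1 : DiffOp K S) a = a := by
  obtain ⟨v, t, rfl⟩ := exists_frac a
  rw [powAct_frac, fracAct, Finset.sum_range_succ', Finset.sum_eq_zero]
  · simp [adPow]
  · intro i _
    rw [adPow_one, zero_smul, map_zero, zero_mul, smul_zero]

theorem powAct_sum {ι : Type*} (c : K) (δ : DiffOp K S) (s : Finset ι)
    (h : ι → Localization.Away g) :
    powAct g c δ (∑ i ∈ s, h i) = ∑ i ∈ s, powAct g c δ (h i) :=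
  map_sum (AddMonoidHom.mk' (powAct g c δ) (powAct_add c δ)) h s

theorem powAct_smul (c r : K) (δ : DiffOp K S) (a : Localization.Away g) :
    powAct g c δ (r • a) = r • powAct g c δ a := by
  obtain ⟨v, t, rfl⟩ := exists_frac a
  have h : r • (algebraMap S (Localization.Away g) v * IsLocalization.Away.invSelf g ^ t) =
      algebraMap S (Localization.Away g) (r • v) * IsLocalization.Away.invSelf g ^ t := by
    rw [Algebra.smul_def r v, map_mul, ← IsScalarTower.algebraMap_apply, mul_assoc,
      Algebra.smul_def r (_ * _)]
  rw [h, powAct_frac, powAct_frac, fracAct, fracAct, Finset.smul_sum]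
  refine Finset.sum_congr rfl fun i _ => ?_
  rw [DiffOp.smul_def, map_smul, ← DiffOp.smul_def, Algebra.smul_def r (adPow g δ i • v), map_mul,
    ← IsScalarTower.algebraMap_apply, mul_assoc, ← Algebra.smul_def, smul_comm]

theorem mul_powAct (c : K) (δ ε : DiffOp K S) (a : Localization.Away g) :
    powAct g c (δ * ε) a = powAct g c δ (powAct g c ε a) := by
  obtain ⟨v, t, rfl⟩ := exists_frac a
  set d := diffOrd δ with hd
  set e := diffOrd ε with he
  have hord : diffOrd (δ * ε) < d + e + 1 := by
    refine Nat.lt_succ_of_le (Nat.sInf_le ?_)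
    change DiffOp.toEnd K S (δ * ε) ∈ diffOpOrder K S (d + e)
    rw [map_mul]
    exact mul_mem_diffOpOrder _ d e rfl (mem_diffOrd δ) (mem_diffOrd ε)
  rw [powAct_frac, powAct_frac, fracAct_eq c (δ * ε) v t hord, fracAct, powAct_sum]
  have h1 : ∑ k ∈ Finset.range (e + 1), powAct g c δ (Ring.choose (c - (t : K)) k •
      (algebraMap S (Localization.Away g) (adPow g ε k • v) *
        IsLocalization.Away.invSelf g ^ (t + k))) =
      ∑ j ∈ Finset.range (d + 1), ∑ k ∈ Finset.range (e + 1),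
        (Ring.choose (c - (t : K)) k * Ring.choose (c - (t : K) - (k : K)) j) •
        (algebraMap S (Localization.Away g) ((adPow g δ j * adPow g ε k) • v) *
          IsLocalization.Away.invSelf g ^ (t + (j + k))) := by
    rw [Finset.sum_comm]
    refine Finset.sum_congr rfl fun k _ => ?_
    rw [powAct_smul, powAct_frac, fracAct, Finset.smul_sum]
    refine Finset.sum_congr rfl fun j _ => ?_
    rw [mul_smul (Ring.choose (c - (t : K)) k), mul_smul (adPow g δ j), Nat.cast_add, sub_sub,
      add_assoc t k j, add_comm k j]
  rw [h1, ← sum_triangle]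
  · refine Finset.sum_congr rfl fun l _ => ?_
    rw [adPow_mul, Finset.sum_smul, map_sum, Finset.sum_mul, Finset.smul_sum]
    refine Finset.sum_congr rfl fun p hp => ?_
    rw [Finset.HasAntidiagonal.mem_antidiagonal] at hp
    subst hp
    have hc := Ring.choose_smul_choose (c - (t : K)) (Nat.le_add_left p.2 p.1)
    rw [Nat.add_sub_cancel, Nat.choose_symm_add.symm] at hc
    rw [← hc, smul_assoc, map_nsmul, smul_mul_assoc, smul_comm, smul_assoc]
  · rintro j k (h | h)
    · rw [adPow_eq_zero g δ h, zero_mul, zero_smul, map_zero, zero_mul, smul_zero]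
    · rw [adPow_eq_zero g ε h, mul_zero, zero_smul, map_zero, zero_mul, smul_zero]

variable (K g) in
/-- The underlying space of the `D_{S|K}`-module `S_g g^c`, for `c ∈ K`: the localization `S_g`,
with `a ∈ S_g` standing for `a g^c`. -/
def PowerModule (_ : K) : Type _ := Localization.Away g

instance (c : K) : AddCommGroup (PowerModule K g c) :=
  inferInstanceAs (AddCommGroup (Localization.Away g))

instance (c : K) : Module K (PowerModule K g c) :=
  inferInstanceAs (Module K (Localization.Away g))

/-- `D_{S|K}` acts on `S_g g^c` by `powAct`. -/
instance (c : K) : Module (DiffOp K S) (PowerModule K g c) where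
  smul δ a := powAct g c δ a
  one_smul := one_powAct c
  mul_smul := mul_powAct c
  smul_zero δ := (AddMonoidHom.mk' (powAct g c δ) (powAct_add c δ)).map_zero
  smul_add := powAct_add c
  add_smul := add_powAct c
  zero_smul a := by
    have h := smul_powAct c (0 : K) (0 : DiffOp K S) a
    rw [zero_smul, zero_smul] at h
    exact h

instance (c : K) : IsScalarTower K (DiffOp K S) (PowerModule K g c) where
  smul_assoc r δ a := smul_powAct c r δ a

end PowerModule

/-! ## Base change to `k(s)` -/

section BaseChange

variable (k : Type*) {R : Type*} [Field k] [CommRing R] [Algebra k R]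

variable (R) in
/-- `R(s) = k(s) ⊗ R`. -/
abbrev RatExt : Type _ := RatFunc k ⊗[k] R

variable {k}

theorem baseChange_mem_diffOpOrder {n : ℕ} {δ : Module.End k R} (h : δ ∈ diffOpOrder k R n) :
    Module.End.baseChangeHom k (RatFunc k) R δ ∈ diffOpOrder (RatFunc k) (RatExt k R) n := by
  have hl : ∀ r : R, Module.End.baseChangeHom k (RatFunc k) R (Algebra.lmul k R r) =
      Algebra.lmul (RatFunc k) (RatExt k R) (1 ⊗ₜ[k] r) := by
    intro r
    ext x
    change (1 : RatFunc k) ⊗ₜ[k] (r * x) = (1 ⊗ₜ[k] r) * (1 ⊗ₜ[k] x)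
    rw [Algebra.TensorProduct.tmul_mul_tmul, one_mul]
  induction n generalizing δ with
  | zero =>
    obtain ⟨r, rfl⟩ := h
    exact ⟨1 ⊗ₜ r, (hl r).symm⟩
  | succ n ih =>
    intro x
    induction x using TensorProduct.induction_on with
    | zero => simp
    | add x y hx hy =>
      rw [map_add, comm_add]
      exact add_mem hx hy
    | tmul c r =>
      have hc : Algebra.lmul (RatFunc k) (RatExt k R) (c ⊗ₜ[k] r) =
          c • Algebra.lmul (RatFunc k) (RatExt k R) (1 ⊗ₜ[k] r) := by
        rw [← map_smul, TensorProduct.smul_tmul', smul_eq_mul, mul_one]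
      rw [hc, comm_smul, ← hl, ← map_mul, ← map_mul, ← map_sub]
      exact Submodule.smul_mem _ c (ih (h r))

/-- The base change `id ⊗ δ ∈ D_{R(s)|k(s)}` of an operator `δ ∈ D_{R|k}`. -/
def DiffOp.baseChange (δ : DiffOp k R) : DiffOp (RatFunc k) (RatExt k R) :=
  ⟨Module.End.baseChangeHom k (RatFunc k) R (DiffOp.toEnd k R δ),
    diffOrd δ, baseChange_mem_diffOpOrder (mem_diffOrd δ)⟩

/-- The subspaces `k(s) ⊗ F i` of `D_{R(s)|k(s)}`: the `k(s)`-spans of the operators `id ⊗ δ`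
with `δ ∈ F i`. -/
def extFiltration (F : ℕ → Submodule k (DiffOp k R)) (i : ℕ) :
    Submodule (RatFunc k) (DiffOp (RatFunc k) (RatExt k R)) :=
  Submodule.span (RatFunc k) (DiffOp.baseChange '' (F i : Set (DiffOp k R)))

instance [CharZero k] : CharZero (RatFunc k) :=
  charZero_of_injective_algebraMap (algebraMap k (RatFunc k)).injective

variable (k) in
/-- The `D_{R(s)|k(s)}`-module `R_f(s) f^s`. Its underlying space is the localization of `R(s)` at
`f`, which is `R_f(s) = k(s) ⊗ R_f`. -/
abbrev FsModule [CharZero k] (f : R) : Type _ :=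
  PowerModule (RatFunc k) (1 ⊗ₜ[k] f : RatExt k R) RatFunc.X

end BaseChange

end

/-! ## Growth of filtrations and the Bernstein inequality -/

section Growth

variable {K M : Type*} [Field K] [AddCommGroup M] [Module K M]

/-! Three facts carry the proof. The first is the Bernstein inequality. In a nonzero module, `F i`
acts faithfully on a piece of `G` of level linear in `i`, so `dim F i` is at most the square of `dim
G` at level `(C + 2) i` (`IsModFiltration.exists_finrank_le_sq`). Hence a nonzero module has
dimension at least half that of `F`. Applied to the successive quotients of a chain of submodules,
the inequality says that each strict inclusion costs at least `√(dim F i)`. A filtration of half the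
dimension and finite multiplicity can pay for only boundedly many, which gives finite length
(`IsModFiltration.isFiniteLength`).

The second is that the hypotheses on `F` survive the passage to `k(s)`. Dimension and multiplicity
are preserved because base change preserves linear independence. Exhaustiveness needs every operator
on `R(s)` to be a finite `k(s)`-combination of operators on `R`. As `R` need not be finitely
generated, this comes from a cardinality argument: `D_{R|k}` has countable dimension, while the dual
of an infinite-dimensional space does not (`DiffOp.exists_sum_baseChangeHom`). Linear simplicity
follows by clearing denominators and specializing `s` to an element of `k` (`IsLinearlySimple.ext`).

The third is an explicit filtration on `R_f(s) f^s`: if multiplication by `f` lies in `F a` and `F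
i` has order at most `C i`, take the fractions with denominator `f ^ (C i)` and numerator in `k(s) ⊗
G ((C a + 1) i)`. It is compatible with the extended filtration (`isModFiltration_fsFiltration`) and
grows no faster than a linear reindexing of `G`. This bounds dimension and multiplicity from above,
and Bernstein gives the dimension from below. -/

theorem filDim_le_of_tendsto {G : ℕ → Submodule K M} {t : ℝ≥0}
    (h : Tendsto (fun i : ℕ => (Module.finrank K (G i) : ℝ) / (i : ℝ) ^ (t : ℝ)) atTop (𝓝 0)) :
    filDim G ≤ t :=
  iInf₂_le t h

theorem tendsto_natCast_mul {c : ℕ} (hc : 0 < c) : Tendsto (fun i : ℕ => c * i) atTop atTop :=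
  tendsto_id.const_mul_atTop' hc

theorem div_rpow_eq_scale (x : ℝ) {c : ℕ} (hc : 0 < c) (i : ℕ) (t : ℝ) :
    x / (i : ℝ) ^ t = (c : ℝ) ^ t * (x / ((c * i : ℕ) : ℝ) ^ t) := by
  have hc' : (0 : ℝ) < (c : ℝ) ^ t := Real.rpow_pos_of_pos (by exact_mod_cast hc) t
  rw [Nat.cast_mul, Real.mul_rpow (Nat.cast_nonneg c) (Nat.cast_nonneg i)]
  rw [mul_div_assoc', mul_div_mul_left _ _ hc'.ne']

/-- Rescaling the index by `c` changes the quotient by `i ^ t` only by the constant `c ^ t`. The two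
ground fields differ because spaces over `k(s)` are compared with spaces over `k`. -/
theorem filDim_le_filDim {K' M' : Type*} [Field K'] [AddCommGroup M'] [Module K' M']
    {G : ℕ → Submodule K M} {G' : ℕ → Submodule K' M'} {c : ℕ} (hc : 0 < c)
    (h : ∀ i, Module.finrank K (G i) ≤ Module.finrank K' (G' (c * i))) :
    filDim G ≤ filDim G' := by
  refine le_iInf₂ fun t ht => filDim_le_of_tendsto ?_
  have h1 := (ht.comp (tendsto_natCast_mul hc)).const_mul ((c : ℝ) ^ (t : ℝ))
  rw [mul_zero] at h1
  refine squeeze_zero (fun i => by positivity) (fun i => ?_) h1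
  rw [div_rpow_eq_scale _ hc]
  simp only [Function.comp]
  gcongr
  exact h i

theorem half_filDim_le {V : Type*} [AddCommGroup V] [Module K V]
    {F : ℕ → Submodule K V} {G : ℕ → Submodule K M} {c : ℕ} (hc : 0 < c)
    (h : ∀ᶠ i in atTop, Module.finrank K (F i) ≤ Module.finrank K (G (c * i)) ^ 2) :
    filDim F / 2 ≤ filDim G := by
  refine le_iInf₂ fun t ht => ENNReal.div_le_of_le_mul ?_
  rw [show (t : ℝ≥0∞) * 2 = ((t * 2 : ℝ≥0) : ℝ≥0∞) by push_cast; rfl]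
  refine filDim_le_of_tendsto ?_
  have h1 := ((ht.comp (tendsto_natCast_mul hc)).const_mul ((c : ℝ) ^ (t : ℝ))).pow 2
  rw [mul_zero, zero_pow two_ne_zero] at h1
  refine squeeze_zero' (Eventually.of_forall fun i => by positivity) (h.mono fun i hi => ?_) h1
  simp only [Function.comp]
  rw [← div_rpow_eq_scale _ hc, div_pow, NNReal.coe_mul, Real.rpow_mul (Nat.cast_nonneg i)]
  simp only [NNReal.coe_ofNat, Real.rpow_ofNat]
  gcongr
  exact_mod_cast hi

theorem filMult_of_lt_top {G : ℕ → Submodule K M} (hd : filDim G < ⊤) :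
    filMult G = limsup (fun i : ℕ => ENNReal.ofReal
      ((Module.finrank K (G i) : ℝ) / (i : ℝ) ^ (filDim G).toReal)) atTop := by
  rw [filMult, if_neg hd.ne]

theorem eventually_finrank_le {G : ℕ → Submodule K M} (hd : filDim G < ⊤) (h : filMult G < ⊤) :
    ∃ B : ℝ, 0 < B ∧ ∀ᶠ i : ℕ in atTop,
      (Module.finrank K (G i) : ℝ) ≤ B * (i : ℝ) ^ (filDim G).toReal := by
  rw [filMult_of_lt_top hd] at h
  obtain ⟨B, hB, hB'⟩ := exists_between h
  refine ⟨B.toReal + 1, by positivity, ?_⟩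
  filter_upwards [eventually_lt_of_limsup_lt hB, eventually_gt_atTop 0] with i hi hi0
  have hpos : (0 : ℝ) < (i : ℝ) ^ (filDim G).toReal :=
    Real.rpow_pos_of_pos (by exact_mod_cast hi0) _
  rw [← div_le_iff₀ hpos]
  exact ((ENNReal.ofReal_le_iff_le_toReal hB'.ne).mp hi.le).trans (by linarith)

theorem filMult_lt_top_of_eventually_le {G : ℕ → Submodule K M} (hd : filDim G < ⊤) {B : ℝ}
    (h : ∀ᶠ i : ℕ in atTop,
      (Module.finrank K (G i) : ℝ) ≤ B * (i : ℝ) ^ (filDim G).toReal) : filMult G < ⊤ := by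
  rw [filMult_of_lt_top hd]
  refine lt_of_le_of_lt (limsup_le_of_le (a := ENNReal.ofReal B) (by isBoundedDefault) ?_)
    ENNReal.ofReal_lt_top
  filter_upwards [h, eventually_gt_atTop 0] with i hi hi0
  have hpos : (0 : ℝ) < (i : ℝ) ^ (filDim G).toReal :=
    Real.rpow_pos_of_pos (by exact_mod_cast hi0) _
  exact ENNReal.ofReal_le_ofReal ((div_le_iff₀ hpos).mpr hi)

/-- Multiplicity is a limsup, so its positivity bounds the growth from below only for infinitely
many `i`. This suffices when the competing bounds hold for all large `i`. -/
theorem frequently_lt_finrank {G : ℕ → Submodule K M} (hd : filDim G < ⊤) (h : 0 < filMult G) :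
    ∃ ε : ℝ, 0 < ε ∧ ∃ᶠ i : ℕ in atTop,
      ε * (i : ℝ) ^ (filDim G).toReal ≤ (Module.finrank K (G i) : ℝ) := by
  rw [filMult_of_lt_top hd] at h
  obtain ⟨ε, hε, hε'⟩ := exists_between h
  have hεt : ε ≠ ⊤ := hε'.ne_top
  refine ⟨ε.toReal, ENNReal.toReal_pos hε.ne' hεt, ?_⟩
  refine ((frequently_lt_of_lt_limsup (by isBoundedDefault) hε').and_eventually
    (eventually_gt_atTop 0)).mono fun i hi => ?_
  have hpos : (0 : ℝ) < (i : ℝ) ^ (filDim G).toReal :=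
    Real.rpow_pos_of_pos (by exact_mod_cast hi.2) _
  exact (le_div_iff₀ hpos).mp ((ENNReal.lt_ofReal_iff_toReal_lt hεt).mp hi.1).le

end Growth

/-! ### The Bernstein inequality and finite length -/

section Bernstein

variable {K A M : Type*} [Field K] [Ring A] [Algebra K A]
  [AddCommGroup M] [Module K M] [Module A M] [IsScalarTower K A M]

theorem IsModFiltration.comap_subtype {F : ℕ → Submodule K A} {G : ℕ → Submodule K M}
    (hG : IsModFiltration F G) (P : Submodule A M) :
    IsModFiltration F fun i => (G i).comap (P.subtype.restrictScalars K) where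
  mono := fun _ _ h => Submodule.comap_mono (hG.mono h)
  exhaustive := fun m => hG.exhaustive m
  finite := fun i => by
    have := hG.finite i
    let T : (G i).comap (P.subtype.restrictScalars K) →ₗ[K] G i :=
      (P.subtype.restrictScalars K).restrict fun x hx => hx
    refine Module.Finite.of_injective T fun x y h => ?_
    exact Subtype.ext (Subtype.ext (congrArg (fun z : G i => (z : M)) h))
  smul_mem := fun i j a ha m hm => hG.smul_mem i j a ha m hm

theorem IsModFiltration.map_mkQ {F : ℕ → Submodule K A} {G : ℕ → Submodule K M}
    (hG : IsModFiltration F G) (P : Submodule A M) :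
    IsModFiltration F fun i => (G i).map (P.mkQ.restrictScalars K) where
  mono := fun _ _ h => Submodule.map_mono (hG.mono h)
  exhaustive := fun m => by
    obtain ⟨m, rfl⟩ := P.mkQ_surjective m
    obtain ⟨i, hi⟩ := hG.exhaustive m
    exact ⟨i, Submodule.mem_map_of_mem (f := P.mkQ.restrictScalars K) hi⟩
  finite := fun i => by
    have := hG.finite i
    exact Module.Finite.map (G i) (P.mkQ.restrictScalars K)
  smul_mem := fun i j a ha m hm => by
    obtain ⟨m, hm, rfl⟩ := hm
    exact ⟨a • m, hG.smul_mem i j a ha m hm, P.mkQ.map_smul a m⟩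

/-- The Bernstein inequality. -/
theorem IsModFiltration.exists_finrank_le_sq [Nontrivial M] {F : ℕ → Submodule K A}
    {G : ℕ → Submodule K M} (hG : IsModFiltration F G) {C : ℕ}
    (hC : ∀ i, ∀ δ ∈ F i, δ ≠ 0 → (1 : A) ∈ F (C * i) * Submodule.span K {δ} * F (C * i)) :
    ∃ i₀, ∀ i, i₀ ≤ i →
      Module.finrank K (F i) ≤ Module.finrank K (G ((C + 2) * i)) ^ 2 := by
  obtain ⟨m, hm⟩ := exists_ne (0 : M)
  obtain ⟨i₀, hi₀⟩ := hG.exhaustive m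
  -- Since `m ∈ G i₀`, the space `G (C i + i₀)` contains `F (C i) m`, and `F i` sends it to level
  -- `(C + 1) i + i₀`, which is at most `(C + 2) i` as soon as `i ≥ i₀`.
  refine ⟨i₀, fun i hi => ?_⟩
  have := hG.finite (C * i + i₀)
  have := hG.finite ((C + 2) * i)
  have hle : i + (C * i + i₀) ≤ (C + 2) * i := by rw [add_mul]; omega
  let T : F i →ₗ[K] G (C * i + i₀) →ₗ[K] G ((C + 2) * i) :=
    LinearMap.mk₂ K (fun δ v => ⟨(δ : A) • (v : M), hG.mono hle (hG.smul_mem _ _ _ δ.2 _ v.2)⟩)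
      (fun a b v => Subtype.ext (add_smul (a : A) (b : A) (v : M)))
      (fun c a v => Subtype.ext (smul_assoc c (a : A) (v : M)))
      (fun a v w => Subtype.ext (smul_add (a : A) (v : M) (w : M)))
      (fun c a v => Subtype.ext (smul_comm c (a : A) (v : M)).symm)
  -- If `δ` kills `F (C i) m`, then `F (C i) δ F (C i)` kills `m`. For `δ ≠ 0` that space contains
  -- `1`, which would force `m = 0`.
  have hT : Function.Injective T := by
    rw [injective_iff_map_eq_zero]
    intro δ hδ
    by_contra hne
    have h1 := hC i δ δ.2 fun h => hne (Subtype.ext h)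
    have hkill : ∀ v ∈ G (C * i + i₀), (δ : A) • v = 0 := fun v hv =>
      congrArg (fun z : G ((C + 2) * i) => (z : M)) (LinearMap.congr_fun hδ ⟨v, hv⟩)
    have h2 : ∀ x ∈ F (C * i) * Submodule.span K {(δ : A)} * F (C * i), x • m = 0 := by
      intro x hx
      induction hx using Submodule.mul_induction_on' with
      | add x _ y _ hx hy => rw [add_smul, hx, hy, add_zero]
      | mem_mul_mem y hy b hb =>
        have hbm := hkill _ (hG.smul_mem _ _ b hb m hi₀)
        induction hy using Submodule.mul_induction_on' with
        | add x _ y _ hx hy => rw [add_mul, add_smul, hx, hy, add_zero]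
        | mem_mul_mem a ha d hd =>
          obtain ⟨c, rfl⟩ := Submodule.mem_span_singleton.mp hd
          rw [mul_smul, mul_smul, smul_assoc, hbm, smul_zero, smul_zero]
    exact hm (by simpa using h2 1 h1)
  calc Module.finrank K (F i)
      ≤ Module.finrank K (G (C * i + i₀) →ₗ[K] G ((C + 2) * i)) :=
        LinearMap.finrank_le_finrank_of_injective hT
    _ = Module.finrank K (G (C * i + i₀)) * Module.finrank K (G ((C + 2) * i)) :=
        Module.finrank_linearMap K K _ _
    _ ≤ Module.finrank K (G ((C + 2) * i)) ^ 2 := by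
        rw [sq]
        exact Nat.mul_le_mul_right _ (Submodule.finrank_mono (hG.mono (by omega)))

/-- Rank-nullity for the map from `G i ∩ Q` to `Q / P`, whose kernel is `G i ∩ P`. -/
theorem finrank_comap_subtype_add {G : ℕ → Submodule K M} {P Q : Submodule A M} (h : P ≤ Q)
    (i : ℕ) [Module.Finite K (G i)] :
    Module.finrank K (((G i).comap (Q.subtype.restrictScalars K)).map
        ((P.submoduleOf Q).mkQ.restrictScalars K)) +
      Module.finrank K ((G i).comap (P.subtype.restrictScalars K)) =
      Module.finrank K ((G i).comap (Q.subtype.restrictScalars K)) := by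
  have hfin : Module.Finite K ((G i).comap (Q.subtype.restrictScalars K)) := by
    let T : (G i).comap (Q.subtype.restrictScalars K) →ₗ[K] G i :=
      (Q.subtype.restrictScalars K).restrict fun x hx => hx
    refine Module.Finite.of_injective T fun x y h => ?_
    exact Subtype.ext (Subtype.ext (congrArg (fun z : G i => (z : M)) h))
  set V := (G i).comap (Q.subtype.restrictScalars K) with hV
  set q := (P.submoduleOf Q).mkQ.restrictScalars K with hq
  have h1 := (q.domRestrict V).finrank_range_add_finrank_ker
  rw [LinearMap.range_domRestrict] at h1
  rw [← h1]
  congr 1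
  refine LinearEquiv.finrank_eq (LinearEquiv.ofBijective
    ({ toFun := fun x => ⟨⟨⟨x.1.1, h x.1.2⟩, x.2⟩, ?_⟩
       map_add' := fun x y => rfl
       map_smul' := fun c x => rfl } :
      (G i).comap (P.subtype.restrictScalars K) →ₗ[K] LinearMap.ker (q.domRestrict V)) ⟨?_, ?_⟩)
  · rw [LinearMap.mem_ker]
    exact (Submodule.Quotient.mk_eq_zero _).mpr x.1.2
  · intro x y hxy
    exact Subtype.ext (Subtype.ext (congrArg
      (fun z : LinearMap.ker (q.domRestrict V) => ((z.1.1 : Q) : M)) hxy))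
  · rintro ⟨⟨⟨x, hxQ⟩, hxV⟩, hx⟩
    exact ⟨⟨⟨x, (Submodule.Quotient.mk_eq_zero (P.submoduleOf Q)).mp
      (LinearMap.mem_ker.mp hx)⟩, hxV⟩, rfl⟩

/-- The Bernstein inequality for the nonzero quotient `Q / P` with its induced filtration. Only the
threshold for `i` depends on `P` and `Q`; the factor `C + 2` does not, so the inequalities can be
added along a chain. -/
theorem IsModFiltration.eventually_add_sqrt_le {F : ℕ → Submodule K A} {G : ℕ → Submodule K M}
    (hG : IsModFiltration F G) {C : ℕ}
    (hC : ∀ i, ∀ δ ∈ F i, δ ≠ 0 → (1 : A) ∈ F (C * i) * Submodule.span K {δ} * F (C * i))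
    {P Q : Submodule A M} (h : P < Q) :
    ∀ᶠ i in atTop, √(Module.finrank K (F i) : ℝ) +
        Module.finrank K ((G ((C + 2) * i)).comap (P.subtype.restrictScalars K)) ≤
      Module.finrank K ((G ((C + 2) * i)).comap (Q.subtype.restrictScalars K)) := by
  have : Nontrivial (Q ⧸ P.submoduleOf Q) := by
    rw [Submodule.Quotient.nontrivial_iff, Ne, Submodule.submoduleOf_eq_top]
    exact h.not_ge
  obtain ⟨i₀, hi₀⟩ :=
    ((hG.comap_subtype Q).map_mkQ (P.submoduleOf Q)).exists_finrank_le_sq hC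
  filter_upwards [eventually_ge_atTop i₀] with i hi
  have := hG.finite ((C + 2) * i)
  rw [← finrank_comap_subtype_add h.le, Nat.cast_add]
  gcongr
  rw [Real.sqrt_le_left (Nat.cast_nonneg _)]
  exact_mod_cast hi₀ i hi

/-- A chain of length `n` forces `n √(dim F i) ≤ dim G ((C + 2) i)` for large `i`. Both sides are
compared with `i ^ e`, where `e = Dim G` is half of `Dim F`, which bounds `n` independently of the
chain. -/
theorem IsModFiltration.isFiniteLength {F : ℕ → Submodule K A} {G : ℕ → Submodule K M}
    (hG : IsModFiltration F G) (hsimple : IsLinearlySimple F) (hdim : filDim F < ⊤)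
    (hpos : 0 < filMult F) (hGdim : filDim G = filDim F / 2) (hGmult : filMult G < ⊤) :
    IsFiniteLength A M := by
  obtain ⟨C, -, hC⟩ := hsimple
  have hd : filDim G < ⊤ := hGdim ▸ ENNReal.div_lt_top hdim.ne two_ne_zero
  obtain ⟨B, hB, hBG⟩ := eventually_finrank_le hd hGmult
  obtain ⟨ε, hε, hεF⟩ := frequently_lt_finrank hdim hpos
  set e := (filDim G).toReal with he
  have hFe : (filDim F).toReal = e * 2 := by
    rw [he, hGdim, ENNReal.toReal_div]
    simp
  have hc : 0 < C + 2 := by omega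
  have hbound : ∀ p : LTSeries (Submodule A M),
      (p.length : ℝ) * √ε ≤ B * ((C + 2 : ℕ) : ℝ) ^ e := by
    intro p
    have hchain : ∀ j (hj : j < p.length + 1), ∀ᶠ i in atTop,
        (j : ℝ) * √(Module.finrank K (F i) : ℝ) ≤
          Module.finrank K ((G ((C + 2) * i)).comap ((p ⟨j, hj⟩).subtype.restrictScalars K)) := by
      intro j
      induction j with
      | zero => intro hj; simp
      | succ j ih =>
        intro hj
        filter_upwards [ih (by omega), hG.eventually_add_sqrt_le hC
          (p.strictMono (a := ⟨j, by omega⟩) (b := ⟨j + 1, hj⟩) (by simp))] with i h1 h2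
        push_cast
        linarith
    -- The lower bound on `F` holds infinitely often and the other bounds for all large `i`, so some
    -- positive `i` satisfies all of them.
    obtain ⟨i, ⟨hi1, hi2⟩, hi3, hi4⟩ := (hεF.and_eventually ((hchain p.length (by omega)).and
      (((tendsto_natCast_mul hc).eventually hBG).and (eventually_gt_atTop 0)))).exists.imp
        fun i h => (⟨⟨h.1, h.2.1⟩, h.2.2⟩ : (_ ∧ _) ∧ _)
    have := hG.finite ((C + 2) * i)
    have hpow : (0 : ℝ) < (i : ℝ) ^ e := Real.rpow_pos_of_pos (by exact_mod_cast hi4) _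
    have h1 : √ε * (i : ℝ) ^ e ≤ √(Module.finrank K (F i) : ℝ) := by
      refine Real.le_sqrt_of_sq_le ?_
      rw [mul_pow, Real.sq_sqrt hε.le]
      rwa [hFe, Real.rpow_mul (Nat.cast_nonneg i), Real.rpow_ofNat] at hi1
    have h2 : Module.finrank K ((G ((C + 2) * i)).comap
        ((p ⟨p.length, by omega⟩).subtype.restrictScalars K)) ≤
        Module.finrank K (G ((C + 2) * i)) := by
      let T : (G ((C + 2) * i)).comap ((p ⟨p.length, by omega⟩).subtype.restrictScalars K)
          →ₗ[K] G ((C + 2) * i) :=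
        ((p ⟨p.length, by omega⟩).subtype.restrictScalars K).restrict fun x hx => hx
      refine LinearMap.finrank_le_finrank_of_injective (f := T) fun x y h => ?_
      exact Subtype.ext (Subtype.ext (congrArg (fun z : G ((C + 2) * i) => (z : M)) h))
    rw [← mul_le_mul_iff_left₀ hpow]
    calc (p.length : ℝ) * √ε * (i : ℝ) ^ e
        = p.length * (√ε * (i : ℝ) ^ e) := by ring
      _ ≤ p.length * √(Module.finrank K (F i) : ℝ) := by gcongr
      _ ≤ Module.finrank K (G ((C + 2) * i)) := hi2.trans (by exact_mod_cast h2)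
      _ ≤ B * (((C + 2) * i : ℕ) : ℝ) ^ e := hi3
      _ = B * ((C + 2 : ℕ) : ℝ) ^ e * (i : ℝ) ^ e := by
        rw [Nat.cast_mul, Real.mul_rpow (Nat.cast_nonneg _) (Nat.cast_nonneg _), mul_assoc]
  -- Finite length means a bound on the chains of submodules; otherwise there would be chains of
  -- every length, against `hbound`.
  rw [← Module.finiteDimensionalOrder_submodule_iff, ← not_infiniteDimensionalOrder_iff]
  intro hinf
  obtain ⟨n, hn⟩ := exists_nat_gt (B * ((C + 2 : ℕ) : ℝ) ^ e / √ε)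
  refine absurd (hbound (LTSeries.withLength _ n)) (not_le.mpr ?_)
  rw [LTSeries.length_withLength]
  exact (div_lt_iff₀ (Real.sqrt_pos.mpr hε)).mp hn

end Bernstein

/-! ## Base change of differential operators to `k(s)` and its components -/

section Components

variable {k R : Type*} [Field k] [CommRing R] [Algebra k R]

/-- The map `φ ⊗ id : k(s) ⊗ R → R` for a linear functional `φ` on `k(s)`. -/
noncomputable def contract (φ : Module.Dual k (RatFunc k)) : RatExt k R →ₗ[k] R :=
  (TensorProduct.lid k R).toLinearMap ∘ₗ φ.rTensor R

@[simp]
theorem contract_tmul (φ : Module.Dual k (RatFunc k)) (c : RatFunc k) (r : R) :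
    contract φ (c ⊗ₜ[k] r) = φ c • r := by
  simp [contract]

theorem contract_add (φ ψ : Module.Dual k (RatFunc k)) (u : RatExt k R) :
    contract (φ + ψ) u = contract φ u + contract ψ u := by
  simp [contract, LinearMap.rTensor_add]

theorem contract_smul (c : k) (φ : Module.Dual k (RatFunc k)) (u : RatExt k R) :
    contract (c • φ) u = c • contract φ u := by
  simp [contract, LinearMap.rTensor_smul]

theorem contract_mul_one_tmul (φ : Module.Dual k (RatFunc k)) (u : RatExt k R) (r : R) :
    contract φ (u * (1 ⊗ₜ[k] r)) = contract φ u * r := by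
  induction u using TensorProduct.induction_on with
  | zero => simp
  | add x y hx hy => rw [add_mul, map_add, hx, hy, map_add, add_mul]
  | tmul c t => simp

/-- Contraction acts coordinatewise, so it can be tested on the `k(s)`-coordinates of an element of
`R(s)`. -/
theorem repr_contract {ι : Type*} (b : Module.Basis ι k R) (φ : Module.Dual k (RatFunc k))
    (u : RatExt k R) (i : ι) :
    b.repr (contract φ u) i = φ ((Algebra.TensorProduct.basis (RatFunc k) b).repr u i) := by
  induction u using TensorProduct.induction_on with
  | zero => simp
  | add x y hx hy => simp only [map_add, Finsupp.add_apply, hx, hy]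
  | tmul c r =>
    rw [contract_tmul, Algebra.TensorProduct.basis_repr_tmul, map_smul]
    simp only [Finsupp.smul_apply, Finsupp.mapRange_apply, smul_eq_mul]
    rw [mul_comm c, ← Algebra.smul_def, map_smul, smul_eq_mul, mul_comm]

/-- The `k`-linear endomorphism `(φ ⊗ id) ∘ T ∘ (1 ⊗ id)` of `R`. -/
noncomputable def endComponent (φ : Module.Dual k (RatFunc k))
    (T : Module.End (RatFunc k) (RatExt k R)) : Module.End k R :=
  contract φ ∘ₗ T.restrictScalars k ∘ₗ TensorProduct.mk k (RatFunc k) R 1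

theorem endComponent_apply (φ : Module.Dual k (RatFunc k))
    (T : Module.End (RatFunc k) (RatExt k R)) (r : R) :
    endComponent φ T r = contract φ (T (1 ⊗ₜ[k] r)) := rfl

/-- Contraction is `R`-linear, so taking components commutes with forming commutators with `r` and
`1 ⊗ r`. -/
theorem endComponent_mem_diffOpOrder (φ : Module.Dual k (RatFunc k)) {n : ℕ}
    {T : Module.End (RatFunc k) (RatExt k R)}
    (h : T ∈ diffOpOrder (RatFunc k) (RatExt k R) n) :
    endComponent φ T ∈ diffOpOrder k R n := by
  induction n generalizing T with
  | zero =>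
    obtain ⟨u, rfl⟩ := h
    refine ⟨contract φ u, LinearMap.ext fun r => ?_⟩
    exact (contract_mul_one_tmul φ u r).symm
  | succ n ih =>
    intro r
    convert ih (h (1 ⊗ₜ r)) using 1
    refine LinearMap.ext fun x => ?_
    simp only [LinearMap.sub_apply, Module.End.mul_apply, endComponent_apply,
      Algebra.coe_lmul_eq_mul, LinearMap.mul_apply', Algebra.TensorProduct.tmul_mul_tmul, one_mul,
      map_sub]
    rw [mul_comm (1 ⊗ₜ[k] r), contract_mul_one_tmul, mul_comm r (contract _ _)]

/-- The components `(φ ⊗ id) ∘ δ ∘ (1 ⊗ id)` of an operator `δ` on `R(s)`, as a linear map in the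
linear functional `φ` on `k(s)`. -/
noncomputable def DiffOp.component (δ : DiffOp (RatFunc k) (RatExt k R)) :
    Module.Dual k (RatFunc k) →ₗ[k] DiffOp k R where
  toFun φ := ⟨endComponent φ (DiffOp.toEnd _ _ δ), diffOrd δ,
    endComponent_mem_diffOpOrder φ (mem_diffOrd δ)⟩
  map_add' φ ψ := DiffOp.toEnd_injective (LinearMap.ext fun _ => contract_add φ ψ _)
  map_smul' c φ := DiffOp.toEnd_injective (LinearMap.ext fun _ => contract_smul c φ _)

theorem DiffOp.component_smul (δ : DiffOp (RatFunc k) (RatExt k R))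
    (φ : Module.Dual k (RatFunc k)) (r : R) :
    δ.component φ • r = contract φ (δ • (1 ⊗ₜ[k] r : RatExt k R)) := rfl

theorem DiffOp.ext_smul {K S : Type*} [CommRing K] [CommRing S] [Algebra K S] {δ ε : DiffOp K S}
    (h : ∀ r : S, δ • r = ε • r) : δ = ε :=
  DiffOp.toEnd_injective (LinearMap.ext h)

theorem DiffOp.ext_one_tmul {δ ε : DiffOp (RatFunc k) (RatExt k R)}
    (h : ∀ r : R, δ • (1 ⊗ₜ[k] r : RatExt k R) = ε • (1 ⊗ₜ[k] r : RatExt k R)) : δ = ε := by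
  refine DiffOp.toEnd_injective ?_
  ext r
  exact h r

variable (k R) in
/-- Base change of differential operators as a ring homomorphism. -/
noncomputable def DiffOp.baseChangeHom : DiffOp k R →+* DiffOp (RatFunc k) (RatExt k R) where
  toFun := DiffOp.baseChange
  map_one' := DiffOp.toEnd_injective (map_one (Module.End.baseChangeHom k (RatFunc k) R))
  map_zero' := DiffOp.toEnd_injective (map_zero (Module.End.baseChangeHom k (RatFunc k) R))
  map_mul' δ ε := DiffOp.toEnd_injective (map_mul (Module.End.baseChangeHom k (RatFunc k) R)
    (DiffOp.toEnd k R δ) (DiffOp.toEnd k R ε))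
  map_add' δ ε := DiffOp.toEnd_injective (map_add (Module.End.baseChangeHom k (RatFunc k) R)
    (DiffOp.toEnd k R δ) (DiffOp.toEnd k R ε))

theorem DiffOp.baseChangeHom_smul_tmul (δ : DiffOp k R) (c : RatFunc k) (r : R) :
    DiffOp.baseChangeHom k R δ • (c ⊗ₜ[k] r : RatExt k R) = c ⊗ₜ[k] (δ • r) := rfl

theorem DiffOp.baseChangeHom_smul (c : k) (δ : DiffOp k R) :
    DiffOp.baseChangeHom k R (c • δ) =
      algebraMap k (RatFunc k) c • DiffOp.baseChangeHom k R δ := by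
  refine DiffOp.ext_one_tmul fun r => ?_
  rw [smul_assoc, baseChangeHom_smul_tmul, baseChangeHom_smul_tmul, smul_assoc,
    TensorProduct.tmul_smul, algebraMap_smul]

theorem DiffOp.baseChangeHom_mulOp (r : R) :
    DiffOp.baseChangeHom k R (mulOp k r) = mulOp (RatFunc k) (1 ⊗ₜ[k] r) := by
  refine DiffOp.ext_one_tmul fun x => ?_
  rw [baseChangeHom_smul_tmul, mulOp_smul, mulOp_smul, Algebra.TensorProduct.tmul_mul_tmul,
    one_mul]

theorem DiffOp.baseChangeHom_adPow (g : R) (δ : DiffOp k R) (i : ℕ) :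
    DiffOp.baseChangeHom k R (adPow g δ i) =
      adPow (1 ⊗ₜ[k] g) (DiffOp.baseChangeHom k R δ) i := by
  induction i with
  | zero => rfl
  | succ i ih => simp only [adPow, map_sub, map_mul, ih, baseChangeHom_mulOp]

/-- Contracting a `k(s)`-linear relation by any functional `φ` gives a `k`-linear relation with
coefficients `φ (c j)`. These all vanish, and functionals separate the elements of `k(s)`. -/
theorem DiffOp.linearIndependent_baseChangeHom {ι : Type*} {e : ι → DiffOp k R}
    (he : LinearIndependent k e) :
    LinearIndependent (RatFunc k) fun i => DiffOp.baseChangeHom k R (e i) := by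
  rw [linearIndependent_iff'] at he ⊢
  intro s c hc i hi
  rw [← Module.forall_dual_apply_eq_zero_iff k]
  intro φ
  refine he s (fun j => φ (c j)) (DiffOp.ext_smul fun r => ?_) i hi
  have h := congrArg (fun δ => contract φ (δ • (1 ⊗ₜ[k] r : RatExt k R))) hc
  simp only [Finset.sum_smul, smul_assoc, baseChangeHom_smul_tmul, map_sum, zero_smul, map_zero,
    TensorProduct.smul_tmul', smul_eq_mul, mul_one, contract_tmul] at h
  simpa only [Finset.sum_smul, smul_assoc, zero_smul] using h

/-- Let `V` be the `k`-span in `k(s)` of all coordinates of the values of `δ` on `1 ⊗ R`. Taking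
components embeds the dual of `V` in `D_{R|k}`, which has countable dimension. An
infinite-dimensional space has a dual of strictly larger dimension, so `V` is finite-dimensional,
and expanding the coordinates in a basis of `V` expands `δ`. -/
theorem DiffOp.exists_sum_baseChangeHom (h : Module.rank k (DiffOp k R) ≤ Cardinal.aleph0)
    (δ : DiffOp (RatFunc k) (RatExt k R)) :
    ∃ (n : ℕ) (c : Fin n → RatFunc k) (ε : Fin n → DiffOp k R),
      δ = ∑ j, c j • DiffOp.baseChangeHom k R (ε j) := by
  set b := Module.Basis.ofVectorSpace k R
  set B := Algebra.TensorProduct.basis (RatFunc k) b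
  let V : Submodule k (RatFunc k) :=
    Submodule.span k {x | ∃ r i, B.repr (δ • (1 ⊗ₜ[k] r : RatExt k R)) i = x}
  have hV : ∀ r i, B.repr (δ • (1 ⊗ₜ[k] r : RatExt k R)) i ∈ V := fun r i =>
    Submodule.subset_span ⟨r, i, rfl⟩
  -- A retraction of `k(s)` onto `V`, by which functionals on `V` extend to `k(s)`.
  obtain ⟨p, hp⟩ := V.subtype.exists_leftInverse_of_injective V.ker_subtype
  have hpV : ∀ v : V, p v = v := fun v => LinearMap.congr_fun hp v
  have hinj : Function.Injective (δ.component ∘ₗ p.dualMap) := by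
    rw [injective_iff_map_eq_zero]
    intro φ hφ
    have hle : V ≤ LinearMap.ker (p.dualMap φ) := by
      refine Submodule.span_le.mpr ?_
      rintro _ ⟨r, i, rfl⟩
      have h1 : contract (p.dualMap φ) (δ • (1 ⊗ₜ[k] r : RatExt k R)) = 0 := by
        rw [← component_smul, ← LinearMap.comp_apply, hφ, zero_smul]
      have h2 := repr_contract b (p.dualMap φ) (δ • (1 ⊗ₜ[k] r : RatExt k R)) i
      rw [h1, map_zero, Finsupp.zero_apply] at h2
      exact h2.symm
    ext v
    simpa [hpV] using hle v.2
  have hfin : Module.Finite k V := by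
    rw [← Module.rank_lt_aleph0_iff]
    by_contra! hinf
    have h1 := LinearMap.lift_rank_le_of_injective _ hinj
    have h2 := (Cardinal.lift_le_aleph0.mpr h)
    have h3 := Cardinal.lift_le_aleph0.mp (h1.trans h2)
    exact absurd (h3.trans hinf) (not_le.mpr (rank_lt_rank_dual hinf))
  set v := Module.finBasis k V
  -- The dual basis expansion in `V`; the components of `δ` along the coordinate functionals are the
  -- operators sought.
  have hsum : ∀ x ∈ V, x = ∑ j, (v j : RatFunc k) •
      algebraMap k (RatFunc k) (p.dualMap (v.coord j) x) := by
    intro x hx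
    have h1 : p x = ⟨x, hx⟩ := hpV ⟨x, hx⟩
    have h2 := congrArg (fun z : V => (z : RatFunc k)) (v.sum_repr ⟨x, hx⟩)
    simp only [Submodule.coe_sum, Submodule.coe_smul, Algebra.smul_def] at h2
    simp only [LinearMap.dualMap_apply, Module.Basis.coord_apply, h1, smul_eq_mul]
    exact h2.symm.trans (Finset.sum_congr rfl fun j _ => mul_comm _ _)
  refine ⟨_, fun j => (v j : RatFunc k), fun j => δ.component (p.dualMap (v.coord j)), ?_⟩
  refine DiffOp.ext_one_tmul fun r => B.repr.injective (Finsupp.ext fun i => ?_)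
  simp only [Finset.sum_smul, smul_assoc, baseChangeHom_smul_tmul, component_smul, map_sum,
    map_smul, Finsupp.finsetSum_apply, Finsupp.smul_apply, B,
    Algebra.TensorProduct.basis_repr_tmul, one_smul, Finsupp.mapRange_apply, repr_contract]
  exact hsum _ (hV r i)

end Components

/-! ## The extended filtration -/

section ExtFiltration

theorem IsAlgFiltration.rank_le_aleph0 {K A : Type*} [Field K] [Ring A] [Algebra K A]
    {F : ℕ → Submodule K A} (hF : IsAlgFiltration F) : Module.rank K A ≤ Cardinal.aleph0 := by
  have hfg : ∀ i, ∃ S : Finset A, Submodule.span K (S : Set A) = F i := fun i => by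
    have := hF.finite i
    exact Module.Finite.iff_fg.mp this
  choose S hS using hfg
  have htop : Submodule.span K (⋃ i, (S i : Set A)) = ⊤ := by
    refine eq_top_iff.mpr fun a _ => ?_
    obtain ⟨i, hi⟩ := hF.exhaustive a
    rw [← hS] at hi
    exact Submodule.span_mono (Set.subset_iUnion (fun i => (S i : Set A)) i) hi
  rw [← rank_top, ← htop]
  refine (rank_span_le _).trans ?_
  rw [Cardinal.le_aleph0_iff_set_countable]
  exact Set.countable_iUnion fun i => (S i).countable_toSet

variable {k R : Type*} [Field k] [CommRing R] [Algebra k R] {F : ℕ → Submodule k (DiffOp k R)}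

theorem baseChangeHom_mem_extFiltration {i : ℕ} {δ : DiffOp k R} (h : δ ∈ F i) :
    DiffOp.baseChangeHom k R δ ∈ extFiltration F i :=
  Submodule.subset_span ⟨δ, h, rfl⟩

theorem extFiltration_eq_span_range {i : ℕ} {ι : Type*} (e : Module.Basis ι k (F i)) :
    extFiltration F i = Submodule.span (RatFunc k)
      (Set.range fun j => DiffOp.baseChangeHom k R (e j : DiffOp k R)) := by
  refine le_antisymm (Submodule.span_le.mpr ?_) (Submodule.span_le.mpr ?_)
  · rintro _ ⟨δ, hδ, rfl⟩
    change DiffOp.baseChangeHom k R δ ∈ _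
    have h1 := congrArg (fun z : F i => (z : DiffOp k R)) (e.linearCombination_repr ⟨δ, hδ⟩)
    simp only [Finsupp.linearCombination_apply, Finsupp.sum, Submodule.coe_sum,
      Submodule.coe_smul] at h1
    rw [← h1, map_sum]
    refine Submodule.sum_mem _ fun j _ => ?_
    rw [DiffOp.baseChangeHom_smul]
    exact Submodule.smul_mem _ _ (Submodule.subset_span ⟨j, rfl⟩)
  · rintro _ ⟨j, rfl⟩
    exact baseChangeHom_mem_extFiltration (e j).2

theorem finrank_extFiltration {i : ℕ} (h : Module.Finite k (F i)) :
    Module.finrank (RatFunc k) (extFiltration F i) = Module.finrank k (F i) := by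
  set e := Module.finBasis k (F i)
  rw [extFiltration_eq_span_range e, finrank_span_eq_card, Fintype.card_fin]
  exact DiffOp.linearIndependent_baseChangeHom
    (e.linearIndependent.map' (F i).subtype (F i).ker_subtype)

/-- Only exhaustiveness is not formal: the finitely many operators in an expansion of `δ` lie in a
common `F i`. -/
theorem IsAlgFiltration.ext (hF : IsAlgFiltration F) : IsAlgFiltration (extFiltration F) where
  mono := fun _ _ h => Submodule.span_mono (Set.image_mono (hF.mono h))
  exhaustive := fun δ => by
    obtain ⟨n, c, ε, rfl⟩ := DiffOp.exists_sum_baseChangeHom hF.rank_le_aleph0 δ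
    choose N hN using fun j => hF.exhaustive (ε j)
    refine ⟨Finset.univ.sup N, Submodule.sum_mem _ fun j _ => Submodule.smul_mem _ _ ?_⟩
    exact baseChangeHom_mem_extFiltration (hF.mono (Finset.le_sup (Finset.mem_univ j)) (hN j))
  finite := fun i => by
    have := hF.finite i
    rw [extFiltration_eq_span_range (Module.finBasis k (F i))]
    exact Module.Finite.span_of_finite _ (Set.finite_range _)
  zero_eq := by
    have h1 : (1 : DiffOp k R) ∈ F 0 := by rw [hF.zero_eq]; exact Submodule.one_le.mp le_rfl
    refine le_antisymm (Submodule.span_le.mpr ?_) ?_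
    · rintro _ ⟨δ, hδ, rfl⟩
      rw [hF.zero_eq, SetLike.mem_coe, Submodule.mem_one] at hδ
      obtain ⟨c, rfl⟩ := hδ
      rw [SetLike.mem_coe, Submodule.mem_one]
      refine ⟨algebraMap k (RatFunc k) c, ?_⟩
      change _ = DiffOp.baseChangeHom k R _
      rw [Algebra.algebraMap_eq_smul_one (A := DiffOp k R), DiffOp.baseChangeHom_smul, map_one,
        Algebra.algebraMap_eq_smul_one (A := DiffOp (RatFunc k) (RatExt k R))]
    · rw [Submodule.one_le, ← map_one (DiffOp.baseChangeHom k R)]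
      exact baseChangeHom_mem_extFiltration h1
  mul_le := fun i j => by
    rw [extFiltration, extFiltration, Submodule.span_mul_span, Submodule.span_le]
    rintro _ ⟨_, ⟨δ, hδ, rfl⟩, _, ⟨ε, hε, rfl⟩, rfl⟩
    change DiffOp.baseChangeHom k R δ * DiffOp.baseChangeHom k R ε ∈ _
    rw [← map_mul]
    exact baseChangeHom_mem_extFiltration (hF.mul_le i j (Submodule.mul_mem_mul hδ hε))

theorem filDim_extFiltration (hF : IsAlgFiltration F) : filDim (extFiltration F) = filDim F := by
  simp only [filDim, finrank_extFiltration (hF.finite _)]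

theorem filMult_extFiltration (hF : IsAlgFiltration F) :
    filMult (extFiltration F) = filMult F := by
  simp only [filMult, finrank_extFiltration (hF.finite _), filDim_extFiltration hF]

/-- A `k(s)`-linear functional on `D_{R(s)|k(s)}` becomes polynomial on the base change of a
finite-dimensional subspace after multiplication by a nonzero polynomial. -/
theorem exists_polynomial_functional (V : Submodule k (DiffOp k R)) [Module.Finite k V]
    (φ : DiffOp (RatFunc k) (RatExt k R) →ₗ[RatFunc k] RatFunc k) :
    ∃ (q : Polynomial k) (Ψ : DiffOp k R →ₗ[k] Polynomial k), q ≠ 0 ∧ ∀ x ∈ V,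
      algebraMap (Polynomial k) (RatFunc k) (Ψ x) =
        algebraMap (Polynomial k) (RatFunc k) q * φ (DiffOp.baseChangeHom k R x) := by
  set e := Module.finBasis k V
  -- A common denominator for the values of the functional on a basis of `V`.
  obtain ⟨q, hq⟩ := IsLocalization.exist_integer_multiples_of_finite
    (nonZeroDivisors (Polynomial k)) fun j => φ (DiffOp.baseChangeHom k R (e j))
  choose P hP using hq
  obtain ⟨Ψ, hΨ⟩ := (e.constr k P).exists_extend
  refine ⟨q, Ψ, nonZeroDivisors.ne_zero q.2, fun x hx => ?_⟩
  have h1 : Ψ x = e.constr k P ⟨x, hx⟩ := LinearMap.congr_fun hΨ ⟨x, hx⟩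
  have h2 := congrArg (fun z : V => (z : DiffOp k R)) (e.sum_repr ⟨x, hx⟩)
  simp only [Submodule.coe_sum, Submodule.coe_smul] at h2
  rw [h1, Module.Basis.constr_apply_fintype, map_sum]
  conv_rhs => rw [← h2]
  rw [map_sum, map_sum, Finset.mul_sum]
  refine Finset.sum_congr rfl fun j _ => ?_
  rw [DiffOp.baseChangeHom_smul, φ.map_smul, smul_eq_mul, mul_left_comm,
    ← Algebra.smul_def (q : Polynomial k), ← hP j, Module.Basis.equivFun_apply, Algebra.smul_def,
    map_mul, ← IsScalarTower.algebraMap_apply]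

/-- The constant `C` is kept. If `1` were outside `F̃ (C i) δ F̃ (C i)`, a functional would separate
them. After clearing denominators in `δ` and in the functional, evaluation of `s` at a suitable
point of the infinite field `k` gives a nonzero `δ' ∈ F i` and a `k`-linear functional that
separates `1` from `F (C i) δ' F (C i)`, contrary to linear simplicity of `F`. -/
theorem IsLinearlySimple.ext [Infinite k] (hF : IsAlgFiltration F) (h : IsLinearlySimple F) :
    IsLinearlySimple (extFiltration F) := by
  obtain ⟨C, hC0, hC⟩ := h
  refine ⟨C, hC0, fun i δ hδ hδ0 => ?_⟩
  by_contra hnot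
  obtain ⟨φ, hφ1, hφ⟩ := Submodule.exists_le_ker_of_notMem hnot
  have := hF.finite i
  have := hF.finite (C * i + i + C * i)
  -- The level `C i + i + C i` holds `1` and all products `a * e j * b` to be evaluated.
  obtain ⟨q, Ψ, hq, hΨ⟩ := exists_polynomial_functional (F (C * i + i + C * i)) φ
  set e := Module.finBasis k (F i)
  rw [extFiltration_eq_span_range e, Submodule.mem_span_range_iff_exists_fun] at hδ
  obtain ⟨c, rfl⟩ := hδ
  obtain ⟨p, hp⟩ := IsLocalization.exist_integer_multiples_of_finite
    (nonZeroDivisors (Polynomial k)) c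
  choose P hP using hp
  have hp0 : algebraMap (Polynomial k) (RatFunc k) p.1 ≠ 0 :=
    (map_ne_zero_iff _ (IsFractionRing.injective _ _)).mpr (nonZeroDivisors.ne_zero p.2)
  have hP' : ∀ j, algebraMap (Polynomial k) (RatFunc k) (P j) =
      algebraMap (Polynomial k) (RatFunc k) p.1 * c j := fun j => by
    rw [hP j, Algebra.smul_def]
  obtain ⟨j₀, hj₀⟩ : ∃ j, P j ≠ 0 := by
    by_contra! hall
    refine hδ0 (Finset.sum_eq_zero fun j _ => ?_)
    have h1 := hP' j
    rw [hall j, map_zero, eq_comm, mul_eq_zero, or_iff_right hp0] at h1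
    rw [h1, zero_smul]
  have h1mem : (1 : DiffOp k R) ∈ F (C * i + i + C * i) :=
    hF.mono (Nat.zero_le _) (by rw [hF.zero_eq]; exact Submodule.one_le.mp le_rfl)
  have hΨ1 : Ψ 1 ≠ 0 := fun h0 => by
    have h1 := hΨ 1 h1mem
    rw [h0, map_zero, map_one, eq_comm, mul_eq_zero] at h1
    exact h1.elim (fun h => hq ((map_eq_zero_iff _ (IsFractionRing.injective _ _)).mp h)) hφ1
  -- At `x` neither `Ψ 1` nor the coefficient `P j₀` vanishes: the first keeps `1` out of the
  -- kernel, the second keeps `δ'` nonzero.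
  obtain ⟨x, hx⟩ : ∃ x : k, (Ψ 1 * P j₀).eval x ≠ 0 := by
    by_contra! hall
    exact mul_ne_zero hΨ1 hj₀ (Polynomial.funext fun x => by rw [hall, Polynomial.eval_zero])
  rw [Polynomial.eval_mul] at hx
  set δ' : F i := ∑ j, (P j).eval x • e j with hδ'
  have hδ'0 : (δ' : DiffOp k R) ≠ 0 := fun h0 => by
    have h2 := Fintype.linearIndependent_iff.mp e.linearIndependent _
      (Subtype.ext h0 : δ' = 0) j₀
    exact right_ne_zero_of_mul hx h2
  have hker : F (C * i) * Submodule.span k {(δ' : DiffOp k R)} * F (C * i) ≤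
      LinearMap.ker (Polynomial.leval x ∘ₗ Ψ) := by
    rw [Submodule.mul_le]
    intro y hy b hb
    rw [LinearMap.mem_ker]
    induction hy using Submodule.mul_induction_on' with
    | add y _ z _ hy hz => rw [add_mul, map_add, hy, hz, add_zero]
    | mem_mul_mem a ha d hd =>
      obtain ⟨r, rfl⟩ := Submodule.mem_span_singleton.mp hd
      rw [mul_smul_comm, smul_mul_assoc, map_smul]
      -- In `k(s)` this sum is `p q` times the value of `φ` on `a δ b`, hence zero. Evaluated at
      -- `x`, it says that the specialized functional kills `a δ' b`.
      have hsum : ∑ j, P j * Ψ (a * e j * b) = 0 := by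
        refine IsFractionRing.injective (Polynomial k) (RatFunc k) ?_
        have h3 : φ (DiffOp.baseChangeHom k R a *
            (∑ j, c j • DiffOp.baseChangeHom k R (e j : DiffOp k R)) *
            DiffOp.baseChangeHom k R b) = 0 :=
          hφ (Submodule.mul_mem_mul (Submodule.mul_mem_mul (baseChangeHom_mem_extFiltration ha)
            (Submodule.mem_span_singleton_self _)) (baseChangeHom_mem_extFiltration hb))
        simp only [Finset.mul_sum, Finset.sum_mul, map_sum, mul_smul_comm, smul_mul_assoc,
          map_smul, smul_eq_mul] at h3
        rw [map_zero, map_sum]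
        refine Eq.trans ?_ ((congrArg (fun z => algebraMap (Polynomial k) (RatFunc k) p.1 *
          (algebraMap (Polynomial k) (RatFunc k) q * z)) h3).trans (by simp))
        simp only [Finset.mul_sum]
        refine Finset.sum_congr rfl fun j _ => ?_
        rw [map_mul, hP', hΨ _ (hF.mul_le _ _ (Submodule.mul_mem_mul
          (hF.mul_le _ _ (Submodule.mul_mem_mul ha (e j).2)) hb)),
          map_mul (DiffOp.baseChangeHom k R), map_mul (DiffOp.baseChangeHom k R)]
        ring
      have h4 : (Polynomial.leval x ∘ₗ Ψ) (a * δ' * b) = 0 := by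
        have h5 := congrArg (Polynomial.eval x) hsum
        rw [Polynomial.eval_finsetSum, Polynomial.eval_zero] at h5
        rw [hδ', ← h5]
        simp only [Submodule.coe_sum, Submodule.coe_smul, Finset.mul_sum, Finset.sum_mul,
          mul_smul_comm, smul_mul_assoc, map_sum, map_smul, LinearMap.comp_apply,
          Polynomial.leval_apply, Polynomial.eval_mul, smul_eq_mul]
      rw [h4, smul_zero]
  exact left_ne_zero_of_mul hx (hker (hC i δ' δ'.2 hδ'0))

end ExtFiltration

/-! ## The filtration on `R_f(s) f^s` -/

section PowerModuleFrac

variable {K S : Type*} [Field K] [CommRing S] [Algebra K S] {g : S}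

variable (g) in
/-- The map `v ↦ (v / g ^ t) g ^ c` from `S` to `S_g g ^ c`. -/
noncomputable def PowerModule.frac (c : K) (t : ℕ) : S →ₗ[K] PowerModule K g c :=
  LinearMap.mulRight K (IsLocalization.Away.invSelf (S := Localization.Away g) g ^ t) ∘ₗ
    (IsScalarTower.toAlgHom K S (Localization.Away g)).toLinearMap

theorem PowerModule.exists_eq_frac (c : K) (m : PowerModule K g c) :
    ∃ v t, m = PowerModule.frac g c t v :=
  exists_frac m

theorem PowerModule.frac_add_pow_mul (c : K) (t n : ℕ) (v : S) :
    PowerModule.frac g c (t + n) (g ^ n * v) = PowerModule.frac g c t v := by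
  have hu := IsLocalization.Away.mul_invSelf (S := Localization.Away g) g
  have hun : algebraMap S (Localization.Away g) g ^ n * IsLocalization.Away.invSelf g ^ n = 1 := by
    rw [← mul_pow, hu, one_pow]
  change (algebraMap S (Localization.Away g) (g ^ n * v) *
    IsLocalization.Away.invSelf g ^ (t + n) : Localization.Away g) =
      algebraMap S (Localization.Away g) v * IsLocalization.Away.invSelf g ^ t
  rw [map_mul, map_pow]
  linear_combination (algebraMap S (Localization.Away g) v *
    IsLocalization.Away.invSelf g ^ t) * hun

variable [CharZero K]

/-- All terms of the action are brought to the denominator `g ^ (t + n)`, which depends on `δ` only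
through the order bound `n`. -/
theorem PowerModule.smul_frac (c : K) (δ : DiffOp K S) (t : ℕ) (v : S) {n : ℕ}
    (hn : DiffOp.toEnd K S δ ∈ diffOpOrder K S n) :
    δ • PowerModule.frac g c t v = ∑ i ∈ Finset.range (n + 1), Ring.choose (c - (t : K)) i •
      PowerModule.frac g c (t + n) (g ^ (n - i) * adPow g δ i • v) := by
  have hord : diffOrd δ < n + 1 := Nat.lt_succ_of_le (Nat.sInf_le hn)
  refine ((powAct_frac c δ v t).trans (fracAct_eq c δ v t hord)).trans ?_
  refine Finset.sum_congr rfl fun i hi => ?_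
  have h : t + n = t + i + (n - i) := by
    have := Finset.mem_range.mp hi
    omega
  rw [h, frac_add_pow_mul]
  rfl

end PowerModuleFrac

/-! ### Compatibility and growth of the filtration by fractions -/

section FsFiltration

variable {k R : Type*} [Field k] [CommRing R] [Algebra k R]
  {F : ℕ → Submodule k (DiffOp k R)} {G : ℕ → Submodule k R}

theorem adPow_mem_of_mem (hF : IsAlgFiltration F) {f : R} {a : ℕ} (hf : mulOp k f ∈ F a)
    {i : ℕ} {δ : DiffOp k R} (hδ : δ ∈ F i) (l : ℕ) : adPow f δ l ∈ F (i + l * a) := by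
  induction l with
  | zero => simpa [adPow] using hδ
  | succ l ih =>
    rw [add_mul, one_mul, ← add_assoc]
    refine sub_mem (hF.mul_le _ _ (Submodule.mul_mem_mul ih hf)) ?_
    rw [add_comm]
    exact hF.mul_le _ _ (Submodule.mul_mem_mul hf ih)

theorem pow_mul_mem_of_mem (hG : IsModFiltration F G) {f : R} {a : ℕ} (hf : mulOp k f ∈ F a)
    {j : ℕ} {v : R} (hv : v ∈ G j) (n : ℕ) : f ^ n * v ∈ G (j + n * a) := by
  induction n with
  | zero => simpa using hv
  | succ n ih =>
    rw [add_mul, one_mul, ← add_assoc, add_comm (j + n * a), pow_succ', mul_assoc,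
      ← mulOp_smul (K := k)]
    exact hG.smul_mem _ _ _ hf _ ih

theorem finrank_baseChange_le {N : Submodule k R} [Module.Finite k N] :
    Module.finrank (RatFunc k) (N.baseChange (RatFunc k)) ≤ Module.finrank k N := by
  rw [← Module.finrank_baseChange (R := RatFunc k) (S := k) (M' := N)]
  exact LinearMap.finrank_le_finrank_of_surjective (N.toBaseChange_surjective (RatFunc k))

variable [CharZero k]

/-- The subspaces `{(v / f ^ (C i)) f ^ s | v ∈ k(s) ⊗ G (b i)}` of `R_f(s) f^s`. -/
noncomputable def fsFiltration (G : ℕ → Submodule k R) (f : R) (C b i : ℕ) :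
    Submodule (RatFunc k) (FsModule k f) :=
  ((G (b * i)).baseChange (RatFunc k)).map
    (PowerModule.frac (1 ⊗ₜ[k] f : RatExt k R) RatFunc.X (C * i))

theorem fsFiltration_eq_span (G : ℕ → Submodule k R) (f : R) (C b i : ℕ) :
    fsFiltration G f C b i = Submodule.span (RatFunc k)
      ((fun v : R => PowerModule.frac (1 ⊗ₜ[k] f : RatExt k R) RatFunc.X (C * i) (1 ⊗ₜ[k] v)) ''
        (G (b * i) : Set R)) := by
  rw [fsFiltration, Submodule.baseChange_eq_span, Submodule.map_span, Submodule.map_coe,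
    Set.image_image]
  rfl

theorem frac_mem_fsFiltration {f : R} {C b i : ℕ} {v : R} (hv : v ∈ G (b * i)) :
    PowerModule.frac (1 ⊗ₜ[k] f : RatExt k R) RatFunc.X (C * i) (1 ⊗ₜ[k] v) ∈
      fsFiltration G f C b i := by
  rw [fsFiltration_eq_span]
  exact Submodule.subset_span ⟨v, hv, rfl⟩

/-- Only an inequality: `f` may be a zero divisor, so a nonzero numerator may become zero in the
localization. -/
theorem finrank_fsFiltration_le (hG : IsModFiltration F G) (f : R) (C b i : ℕ) :
    Module.finrank (RatFunc k) (fsFiltration G f C b i) ≤ Module.finrank k (G (b * i)) := by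
  have := hG.finite (b * i)
  have : Module.Finite (RatFunc k) ((G (b * i)).baseChange (RatFunc k)) :=
    Module.Finite.of_surjective _ ((G (b * i)).toBaseChange_surjective (RatFunc k))
  exact (Submodule.finrank_map_le _ _).trans finrank_baseChange_le

/-- An operator in `F i` raises the exponent of the denominator by `C i`. In the `l`-th term the
commutator lies in `F (i + l a)` and the factor `f ^ (C i - l)` adds `(C i - l) a`, so the level of
the numerator rises by `i + C i a = (C a + 1) i` whatever `l` is. This is the origin of the factor
`C a + 1`. -/
theorem smul_mem_fsFiltration (hF : IsAlgFiltration F) (hG : IsModFiltration F G) {C : ℕ}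
    (hC : ∀ i, ∀ δ ∈ F i, DiffOp.toEnd k R δ ∈ diffOpOrder k R (C * i)) {f : R} {a : ℕ}
    (hf : mulOp k f ∈ F a) (i j : ℕ) (δ : DiffOp (RatFunc k) (RatExt k R))
    (hδ : δ ∈ extFiltration F i) (m : FsModule k f)
    (hm : m ∈ fsFiltration G f C (C * a + 1) j) :
    δ • m ∈ fsFiltration G f C (C * a + 1) (i + j) := by
  induction hδ using Submodule.span_induction with
  | zero => rw [zero_smul]; exact zero_mem _
  | add x y _ _ hx hy => rw [add_smul]; exact add_mem hx hy
  | smul c x _ hx => rw [smul_assoc]; exact Submodule.smul_mem _ c hx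
  | mem x hx =>
    obtain ⟨ε, hε, rfl⟩ := hx
    rw [fsFiltration_eq_span] at hm
    induction hm using Submodule.span_induction with
    | zero => rw [smul_zero]; exact zero_mem _
    | add x y _ _ hx hy => rw [smul_add]; exact add_mem hx hy
    | smul c x _ hx => rw [smul_comm]; exact Submodule.smul_mem _ c hx
    | mem x hx =>
      obtain ⟨v, hv, rfl⟩ := hx
      dsimp only
      rw [PowerModule.smul_frac _ _ _ _ (n := C * i) (baseChange_mem_diffOpOrder (hC i ε hε))]
      refine Submodule.sum_mem _ fun l hl => Submodule.smul_mem _ _ ?_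
      have hl' : l ≤ C * i := Nat.lt_succ_iff.mp (Finset.mem_range.mp hl)
      have h1 : (1 ⊗ₜ[k] f : RatExt k R) ^ (C * i - l) *
          adPow (1 ⊗ₜ[k] f : RatExt k R) ε.baseChange l • (1 ⊗ₜ[k] v : RatExt k R) =
          1 ⊗ₜ[k] (f ^ (C * i - l) * adPow f ε l • v) := by
        change _ ^ _ * adPow _ (DiffOp.baseChangeHom k R ε) l • _ = _
        rw [← DiffOp.baseChangeHom_adPow, DiffOp.baseChangeHom_smul_tmul,
          Algebra.TensorProduct.tmul_pow, Algebra.TensorProduct.tmul_mul_tmul, one_pow, one_mul]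
      rw [h1, show C * j + C * i = C * (i + j) by ring]
      refine frac_mem_fsFiltration ?_
      have h2 := pow_mul_mem_of_mem hG hf
        (hG.smul_mem _ _ _ (adPow_mem_of_mem hF hf hε l) v hv) (C * i - l)
      convert h2 using 2
      obtain ⟨r, hr⟩ := Nat.exists_eq_add_of_le hl'
      rw [hr, Nat.add_sub_cancel_left, add_mul, add_mul, mul_add, mul_add, mul_right_comm C a i, hr]
      ring

/-- The denominators change with the index, so this is not monotonicity of `G` alone; it is
compatibility applied to `1`, taken as an element of level `1`. -/
theorem fsFiltration_mono (hF : IsAlgFiltration F) (hG : IsModFiltration F G) {C : ℕ}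
    (hC : ∀ i, ∀ δ ∈ F i, DiffOp.toEnd k R δ ∈ diffOpOrder k R (C * i)) {f : R} {a : ℕ}
    (hf : mulOp k f ∈ F a) : Monotone (fsFiltration G f C (C * a + 1)) := by
  refine monotone_nat_of_le_succ fun j m hm => ?_
  have h1 : (1 : DiffOp (RatFunc k) (RatExt k R)) ∈ extFiltration F 1 :=
    hF.ext.mono zero_le_one (by rw [hF.ext.zero_eq]; exact Submodule.one_le.mp le_rfl)
  have h2 := smul_mem_fsFiltration hF hG hC hf 1 j 1 h1 m hm
  rwa [one_smul, add_comm 1 j] at h2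

theorem isModFiltration_fsFiltration (hF : IsAlgFiltration F) (hG : IsModFiltration F G) {C : ℕ}
    (hC0 : 0 < C) (hC : ∀ i, ∀ δ ∈ F i, DiffOp.toEnd k R δ ∈ diffOpOrder k R (C * i)) {f : R}
    {a : ℕ} (hf : mulOp k f ∈ F a) :
    IsModFiltration (extFiltration F) (fsFiltration G f C (C * a + 1)) where
  mono := fsFiltration_mono hF hG hC hf
  finite := fun i => by
    have := hG.finite ((C * a + 1) * i)
    have : Module.Finite (RatFunc k) ((G ((C * a + 1) * i)).baseChange (RatFunc k)) :=
      Module.Finite.of_surjective _ ((G ((C * a + 1) * i)).toBaseChange_surjective (RatFunc k))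
    exact Module.Finite.map _ _
  smul_mem := smul_mem_fsFiltration hF hG hC hf
  exhaustive := fun m => by
    obtain ⟨u, t, rfl⟩ := PowerModule.exists_eq_frac _ m
    induction u using TensorProduct.induction_on with
    | zero => exact ⟨0, by rw [map_zero]; exact zero_mem _⟩
    | add x y hx hy =>
      obtain ⟨i, hi⟩ := hx
      obtain ⟨j, hj⟩ := hy
      have hmono := fsFiltration_mono hF hG hC hf
      exact ⟨max i j, by
        rw [map_add]
        exact add_mem (hmono (le_max_left i j) hi) (hmono (le_max_right i j) hj)⟩
    | tmul c r =>
      obtain ⟨j, hj⟩ := hG.exhaustive r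
      -- Level `j + t` is high enough for both parts: its denominator `f ^ (C (j + t))` absorbs `f ^
      -- t`, since `C ≥ 1`, and its numerators contain `r` times the compensating power of `f`.
      have ht : t ≤ C * (j + t) := by nlinarith
      refine ⟨j + t, ?_⟩
      rw [show c ⊗ₜ[k] r = c • (1 ⊗ₜ[k] r : RatExt k R) by
        rw [TensorProduct.smul_tmul', smul_eq_mul, mul_one], map_smul,
        ← PowerModule.frac_add_pow_mul _ t (C * (j + t) - t), Nat.add_sub_cancel' ht,
        Algebra.TensorProduct.tmul_pow, Algebra.TensorProduct.tmul_mul_tmul, one_pow, one_mul]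
      refine Submodule.smul_mem _ c (frac_mem_fsFiltration ?_)
      refine hG.mono ?_ (pow_mul_mem_of_mem hG hf hj _)
      calc j + (C * (j + t) - t) * a ≤ (j + t) + C * (j + t) * a := by
            gcongr <;> omega
        _ = (C * a + 1) * (j + t) := by ring

end FsFiltration

/-! ### The theorem -/

theorem mainTheorem10 {k : Type*} [Field k] [CharZero k] {R : Type*} [CommRing R] [Algebra k R]
    (F : ℕ → Submodule k (DiffOp k R)) (hF : IsAlgFiltration F) (hFord : IsDominatedByOrder F)
    (hsimple : IsLinearlySimple F) (hdim : filDim F < ⊤)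
    (hpos : 0 < filMult F) (hfin : filMult F < ⊤)
    (hR : IsHolonomic R F) (f : R) (hf : f ≠ 0) :
    IsHolonomic (FsModule k f) (extFiltration F) ∧
      IsFiniteLength (DiffOp (RatFunc k) (RatExt k R)) (FsModule k f) := by
  have hinf : Infinite k := CharZero.infinite k
  have hdimE := filDim_extFiltration hF
  have hmultE := filMult_extFiltration hF
  have hsimpleE := hsimple.ext hF
  have hdimE' : filDim (extFiltration F) < ⊤ := hdimE ▸ hdim
  have hposE : 0 < filMult (extFiltration F) := hmultE ▸ hpos
  have hfinE : filMult (extFiltration F) < ⊤ := hmultE ▸ hfin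
  -- The module vanishes when `f` is nilpotent; the Bernstein inequality applies only to nonzero
  -- modules.
  rcases subsingleton_or_nontrivial (FsModule k f) with hsub | hnon
  · exact ⟨⟨hF.ext, hsimpleE, hdimE', hposE, hfinE, Or.inl hsub⟩, IsFiniteLength.of_subsingleton⟩
  rcases hR.holonomic with hR0 | ⟨G, hG, hGdim, hGmult⟩
  · exact absurd (Subsingleton.elim f 0) hf
  obtain ⟨C, hC0, hC⟩ := hFord
  obtain ⟨a, ha⟩ := hF.exhaustive (mulOp k f)
  have hΓ := isModFiltration_fsFiltration hF hG hC0 hC ha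
  set Γ := fsFiltration G f C (C * a + 1)
  have hle : ∀ i, Module.finrank (RatFunc k) (Γ i) ≤ Module.finrank k (G ((C * a + 1) * i)) :=
    finrank_fsFiltration_le hG f C (C * a + 1)
  -- The upper bound comes from comparison with `G`, the lower one from the Bernstein inequality
  -- over `k(s)`.
  have hΓdim : filDim Γ = filDim (extFiltration F) / 2 := by
    refine le_antisymm ?_ ?_
    · rw [hdimE, ← hGdim]
      exact filDim_le_filDim (Nat.succ_pos _) hle
    · obtain ⟨D, hD0, hD⟩ := hsimpleE
      obtain ⟨i₀, hi₀⟩ := hΓ.exists_finrank_le_sq hD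
      exact half_filDim_le (Nat.succ_pos _) (eventually_atTop.mpr ⟨i₀, hi₀⟩)
  have hGd : filDim G < ⊤ := hGdim ▸ ENNReal.div_lt_top hdim.ne two_ne_zero
  have hΓG : filDim Γ = filDim G := by rw [hΓdim, hdimE, hGdim]
  have hΓmult : filMult Γ < ⊤ := by
    obtain ⟨B, hB, hBG⟩ := eventually_finrank_le hGd hGmult
    refine filMult_lt_top_of_eventually_le (hΓG ▸ hGd)
      (B := B * ((C * a + 1 : ℕ) : ℝ) ^ (filDim G).toReal) ?_
    filter_upwards [(tendsto_natCast_mul (Nat.succ_pos (C * a))).eventually hBG] with i hi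
    rw [hΓG, mul_assoc, ← Real.mul_rpow (Nat.cast_nonneg _) (Nat.cast_nonneg _), ← Nat.cast_mul]
    exact (Nat.cast_le.mpr (hle i)).trans hi
  exact ⟨⟨hF.ext, hsimpleE, hdimE', hposE, hfinE, Or.inr ⟨Γ, hΓ, hΓdim, hΓmult⟩⟩,
    hΓ.isFiniteLength hsimpleE hdimE' hposE hΓdim hΓmult⟩
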